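/- Let $c,d\ge 1$ be integers, let $\Gamma$ be one of the Baumslag--Solitar groups $\langle a,b\mid ab^c=b^da\rangle$ or $\langle a,b\mid ab^c=b^{-d}a\rangle$, and let $\Lambda\subseteq\Gamma$ be the submonoid generated by $a$ and $b$. For $\alpha,\beta\in\Lambda$ say that $\beta$ extends $\alpha$ (and that $\alpha$ is an initial segment of $\beta$) if $\beta\in\alpha\Lambda$. Let $\Lambda^*$ be the set of nonempty subsets $C\subseteq\Lambda$ that are directed (any two elements of $C$ have a common extension in $C$) and hereditary (closed under initial segments). For $E=\alpha\Lambda\setminus\bigcup_{i=1}^n\beta_i\Lambda$ with $n\ge 0$ and $\beta_i\in\alpha\Lambda\setminus\{\alpha\}$, put $\widehat E=\{C\in\Lambda^*: C\cap\gamma\Lambda\subseteq E\text{ for some }\gamma\in C\}$, and give $\Lambda^*$ the topology generated by the sets $\widehat E$. Let $\partial\Lambda$ be the closure in $\Lambda^*$ of the set of elements that are maximal for inclusion. For $\alpha\in\Lambda$ and $x\in\Lambda^*$ let $\alpha x\in\Lambda^*$ be the set of all initial segments of the elements $\alpha\beta$, $\beta\in x$. Let $G$ be the groupoid with unit space $\Lambda^*$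 whose elements are the classes $[\alpha,\beta,x]$ of triples in $\Lambda\times\Lambda\times\Lambda^*$ for the equivalence relation in which $(\alpha,\beta,x)\sim(\alpha',\beta',x')$ if there are $y\in\Lambda^*$ and $\gamma,\gamma'\in\Lambda$ with $x=\gamma y$, $x'=\gamma'y$, $\alpha\gamma=\alpha'\gamma'$ and $\beta\gamma=\beta'\gamma'$. The range and source of $[\alpha,\beta,x]$ are $\alpha x$ and $\beta x$, its inverse is $[\beta,\alpha,x]$, and $[\alpha,\beta,\xi z]\,[\gamma,\delta,\eta z]=[\alpha\xi,\delta\eta,z]$ whenever $\beta\xi=\gamma\eta$. The topology of $G$ is generated by the sets $\{[\alpha,\beta,x]:x\in\widehat E\}$. Let $G|_{\partial\Lambda}$ be the subgroupoid of the elements whose source and range lie in $\partial\Lambda$, with the subspace topology. For a groupoid $H$ with unit space $H^0$, range $r$ and source $s$, an open bisection is an open subset of $H$ on which $r$ and $s$ are injective. $H$ is minimal if $\emptyset$ and $H^0$ are its only open invariant subsets of $H^0$; topologically free if the units with trivial isotropy are dense in $H^0$; contractive if for every nonempty open $U\subseteq H^0$ there is an open bisection $S$ with $s(S)=H^0$ and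 $\overline{r(S)}\subsetneq U$; and locally contractive if for every nonempty open $U\subseteq H^0$ there are an open set $V\subseteq U$ and an open bisection $S$ with $\overline V\subseteq s(S)$ and $r(S\overline V)\subsetneq V$. Then: 1. $G|_{\partial\Lambda}$ is minimal. 2. $G|_{\partial\Lambda}$ is contractive if and only if $d>1$; likewise it is locally contractive if and only if $d>1$. 3. $G|_{\partial\Lambda}$ is topologically free if and only if $d\nmid c$. -/

import Mathlib

open CategoryTheory Topology

/-! ## Properties of topological groupoids

`X` is the unit space, a morphism `f : x ⟶ y` is an element of the groupoid with source `x` and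
range `y` (so `f ≫ g` is the groupoid product `g f`), and `Quiver.Total X`, the type of all
elements of the groupoid, carries a topology. -/

/-- A set of units is invariant if it contains the range of every element whose source it
contains. -/
def IsInvariantSet {X : Type*} [Groupoid X] (U : Set X) : Prop :=
  ∀ ⦃x y : X⦄, (x ⟶ y) → x ∈ U → y ∈ U

/-- A groupoid is minimal if the only open invariant sets of units are the empty set and the whole
unit space. -/
def IsMinimalGroupoid (X : Type*) [TopologicalSpace X] [Groupoid X] : Prop :=
  ∀ U : Set X, IsOpen U → IsInvariantSet U → U = ∅ ∨ U = Set.univ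

/-- A groupoid is topologically free if the units with trivial isotropy are dense in the unit
space. -/
def IsTopologicallyFree (X : Type*) [TopologicalSpace X] [Groupoid X] : Prop :=
  Dense {x : X | ∀ g : x ⟶ x, g = 𝟙 x}

/-- An open bisection of an étale groupoid: an open set of elements on which the source map and the
range map are injective. -/
structure IsOpenBisection {X : Type*} [Groupoid X] [TopologicalSpace (Quiver.Total X)]
    (S : Set (Quiver.Total X)) : Prop where
  isOpen : IsOpen S
  injOn_source : Set.InjOn (fun g => g.left) S
  injOn_range : Set.InjOn (fun g => g.right) S

/-- The translate `r (S V)` of a set of units `V` by a bisection `S`. -/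
def bisectionImage {X : Type*} [Groupoid X] (S : Set (Quiver.Total X)) (V : Set X) : Set X :=
  (fun g => g.right) '' {g | g ∈ S ∧ g.left ∈ V}

/-- Local contractivity (Anantharaman-Delaroche): every nonempty open set `U` of units contains an
open set `V` whose closure is mapped by some open bisection onto a proper subset of `V`. -/
def IsLocallyContractive (X : Type*) [TopologicalSpace X] [Groupoid X]
    [TopologicalSpace (Quiver.Total X)] : Prop :=
  ∀ U : Set X, IsOpen U → U.Nonempty →
    ∃ V : Set X, IsOpen V ∧ V ⊆ U ∧
      ∃ S : Set (Quiver.Total X), IsOpenBisection S ∧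
        closure V ⊆ (fun g => g.left) '' S ∧ bisectionImage S (closure V) ⊂ V

/-- Contractivity: for every nonempty open set `U` of units there is an open bisection whose source
is the whole unit space and whose range has closure properly contained in `U`.
(With `V = U` this implies local contractivity.) -/
def IsContractive (X : Type*) [TopologicalSpace X] [Groupoid X]
    [TopologicalSpace (Quiver.Total X)] : Prop :=
  ∀ U : Set X, IsOpen U → U.Nonempty →
    ∃ S : Set (Quiver.Total X), IsOpenBisection S ∧
      (fun g => g.left) '' S = Set.univ ∧ closure (bisectionImage S Set.univ) ⊂ U

/-! ## Directed hereditary sets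

A category of paths with one vertex is a cancellative monoid `M` without nontrivial units.
`α ∣ β` means that `β` extends `α`, that is, `β = α * α'` for some `α'`. -/

/-- The (nonempty) directed hereditary subsets of `M`. -/
@[ext]
structure DirHered (M : Type*) [Monoid M] where
  carrier : Set M
  nonempty : carrier.Nonempty
  directed : ∀ α ∈ carrier, ∀ β ∈ carrier, ∃ γ ∈ carrier, α ∣ γ ∧ β ∣ γ
  hereditary : ∀ β ∈ carrier, ∀ α, α ∣ β → α ∈ carrier

namespace DirHered

variable {M : Type*} [Monoid M]

/-- The basic set `αΛ \ ⋃ β ∈ F, βΛ`. -/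
def basicSet (α : M) (F : Finset M) : Set M :=
  {δ | α ∣ δ ∧ ∀ β ∈ F, ¬ β ∣ δ}

/-- `Ê = {C : C ∩ γΛ ⊆ E for some γ ∈ C}`. -/
def hat (E : Set M) : Set (DirHered M) :=
  {C | ∃ γ ∈ C.carrier, C.carrier ∩ {δ | γ ∣ δ} ⊆ E}

/-- The topology generated by the sets `Ê`, where `E = αΛ \ (β₁Λ ∪ … ∪ βₙΛ)` and
`βᵢ ∈ αΛ \ {α}`. -/
instance : TopologicalSpace (DirHered M) :=
  TopologicalSpace.generateFrom
    {W | ∃ (α : M) (F : Finset M), (∀ β ∈ F, α ∣ β ∧ β ≠ α) ∧ W = hat (basicSet α F)}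

/-- The directed hereditary sets that are maximal for inclusion. -/
def maximals (M : Type*) [Monoid M] : Set (DirHered M) :=
  {C | ∀ D : DirHered M, C.carrier ⊆ D.carrier → D = C}

/-- The boundary: the closure of the set of maximal directed hereditary sets. -/
def boundary (M : Type*) [Monoid M] : Set (DirHered M) :=
  closure (maximals M)

/-- `α x`: the set of all initial segments of the elements `α β`, `β ∈ x`. -/
def shift (α : M) (x : DirHered M) : DirHered M where
  carrier := {δ | ∃ β ∈ x.carrier, δ ∣ α * β}
  nonempty := by
    obtain ⟨β, hβ⟩ := x.nonempty
    exact ⟨α * β, β, hβ, dvd_refl _⟩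
  directed := by
    rintro δ ⟨β, hβ, hδ⟩ δ' ⟨β', hβ', hδ'⟩
    obtain ⟨γ, hγ, h, h'⟩ := x.directed β hβ β' hβ'
    exact ⟨α * γ, ⟨γ, hγ, dvd_refl _⟩, hδ.trans (mul_dvd_mul_left α h),
      hδ'.trans (mul_dvd_mul_left α h')⟩
  hereditary := by
    rintro δ ⟨β, hβ, hδ⟩ ε hε
    exact ⟨β, hβ, hε.trans hδ⟩

theorem shift_one (x : DirHered M) : shift 1 x = x := by
  ext δ
  constructor
  · rintro ⟨β, hβ, h⟩
    exact x.hereditary β hβ δ (by simpa using h)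
  · intro h
    exact ⟨δ, h, by simp⟩

theorem shift_mul (α β : M) (x : DirHered M) : shift (α * β) x = shift α (shift β x) := by
  ext δ
  constructor
  · rintro ⟨γ, hγ, h⟩
    exact ⟨β * γ, ⟨γ, hγ, dvd_refl _⟩, by rwa [← mul_assoc]⟩
  · rintro ⟨γ, ⟨ε, hε, h'⟩, h⟩
    exact ⟨ε, hε, by rw [mul_assoc]; exact h.trans (mul_dvd_mul_left α h')⟩

variable [IsLeftCancelMul M]

theorem dvd_of_mul_dvd_mul_left' {α β γ : M} (h : α * β ∣ α * γ) : β ∣ γ := by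
  obtain ⟨δ, hδ⟩ := h
  exact ⟨δ, mul_left_cancel (by rw [hδ, mul_assoc])⟩

theorem mul_mem_shift {α β : M} {x : DirHered M} :
    α * β ∈ (shift α x).carrier ↔ β ∈ x.carrier := by
  constructor
  · rintro ⟨γ, hγ, h⟩
    exact x.hereditary γ hγ β (dvd_of_mul_dvd_mul_left' h)
  · intro h
    exact ⟨β, h, dvd_refl _⟩

theorem shift_injective (α : M) : Function.Injective (shift α) := by
  intro x y h
  ext β
  rw [← mul_mem_shift (α := α), h, mul_mem_shift]

theorem exists_shift_of_mem {ξ : M} {x : DirHered M} (h : ξ ∈ x.carrier) :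
    ∃ z, x = shift ξ z := by
  refine ⟨⟨{ζ | ξ * ζ ∈ x.carrier}, ⟨1, by simpa using h⟩, ?_, ?_⟩, ?_⟩
  · intro ζ hζ ζ' hζ'
    obtain ⟨γ, hγ, ⟨u, rfl⟩, h2⟩ := x.directed _ hζ _ hζ'
    exact ⟨ζ * u, by simpa [mul_assoc] using hγ, dvd_mul_right _ _,
      dvd_of_mul_dvd_mul_left' (α := ξ) (by simpa [mul_assoc] using h2)⟩
  · intro ζ hζ ζ' hd
    exact x.hereditary _ hζ _ (mul_dvd_mul_left ξ hd)
  · ext δ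
    constructor
    · intro hδ
      obtain ⟨γ, hγ, ⟨u, rfl⟩, h2⟩ := x.directed _ h _ hδ
      exact ⟨u, hγ, h2⟩
    · rintro ⟨β, hβ, hd⟩
      exact x.hereditary _ hβ _ hd

/-- If `α x = β y`, then `x = ξ z`, `y = η z` and `α ξ = β η` for suitable `ξ`, `η`, `z`. -/
theorem exists_common {α β : M} {x y : DirHered M} (h : shift α x = shift β y) :
    ∃ (ξ η : M) (z : DirHered M), x = shift ξ z ∧ y = shift η z ∧ α * ξ = β * η := by
  obtain ⟨μ, hμ⟩ := x.nonempty
  obtain ⟨ν, hν⟩ := y.nonempty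
  have hα : α ∈ (shift α x).carrier := ⟨μ, hμ, dvd_mul_right _ _⟩
  have hβ : β ∈ (shift α x).carrier := by rw [h]; exact ⟨ν, hν, dvd_mul_right _ _⟩
  obtain ⟨ε, hε, ⟨ξ, hξ⟩, ⟨η, hη⟩⟩ := (shift α x).directed _ hα _ hβ
  obtain ⟨z, hz⟩ := exists_shift_of_mem (mul_mem_shift.1 (hξ ▸ hε))
  have e : α * ξ = β * η := hξ.symm.trans hη
  refine ⟨ξ, η, z, hz, shift_injective β ?_, e⟩
  rw [← h, hz, ← shift_mul, ← shift_mul, e]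

/-! ## The groupoid of `M` -/

/-- `(α, β, x) ∼ (α', β', x')` if there are `y`, `γ`, `γ'` with `x = γ y`, `x' = γ' y`,
`α γ = α' γ'` and `β γ = β' γ'`. -/
def rel (p q : M × M × DirHered M) : Prop :=
  ∃ (y : DirHered M) (γ γ' : M), p.2.2 = shift γ y ∧ q.2.2 = shift γ' y ∧
    p.1 * γ = q.1 * γ' ∧ p.2.1 * γ = q.2.1 * γ'

theorem rel_equivalence : Equivalence (rel (M := M)) where
  refl p := ⟨p.2.2, 1, 1, (shift_one _).symm, (shift_one _).symm, rfl, rfl⟩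
  symm := by
    rintro p q ⟨y, γ, γ', h1, h2, h3, h4⟩
    exact ⟨y, γ', γ, h2, h1, h3.symm, h4.symm⟩
  trans := by
    rintro p q r ⟨y, γ, γ', h1, h2, h3, h4⟩ ⟨z, δ, δ', k1, k2, k3, k4⟩
    obtain ⟨ξ, η, w, hy, hz, e⟩ := exists_common (h2.symm.trans k1)
    refine ⟨w, γ * ξ, δ' * η, by rw [h1, hy, shift_mul], by rw [k2, hz, shift_mul], ?_, ?_⟩
    · rw [← mul_assoc, h3, mul_assoc, e, ← mul_assoc, k3, mul_assoc]
    · rw [← mul_assoc, h4, mul_assoc, e, ← mul_assoc, k4, mul_assoc]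

/-- The equivalence relation on triples. -/
def tripleSetoid (M : Type*) [Monoid M] [IsLeftCancelMul M] : Setoid (M × M × DirHered M) :=
  ⟨rel, rel_equivalence⟩

/-- The set of elements of the groupoid of `M`. -/
def PathGroupoid (M : Type*) [Monoid M] [IsLeftCancelMul M] : Type _ :=
  Quotient (tripleSetoid M)

/-- The class `[α, β, x]`. -/
def cls (α β : M) (x : DirHered M) : PathGroupoid M :=
  Quotient.mk (tripleSetoid M) (α, β, x)

theorem cls_eq_iff {α β α' β' : M} {x x' : DirHered M} :
    cls α β x = cls α' β' x' ↔ rel (α, β, x) (α', β', x') :=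
  Quotient.eq (r := tripleSetoid M)

theorem cls_shift (α β ξ : M) (z : DirHered M) :
    cls α β (shift ξ z) = cls (α * ξ) (β * ξ) z :=
  cls_eq_iff.2 ⟨z, ξ, 1, rfl, (shift_one z).symm, by simp, by simp⟩

theorem exists_cls (g : PathGroupoid M) : ∃ α β x, g = cls α β x := by
  obtain ⟨⟨α, β, x⟩, rfl⟩ := Quotient.exists_rep g
  exact ⟨α, β, x, rfl⟩

/-- The range `r [α, β, x] = α x`. -/
def rng : PathGroupoid M → DirHered M :=
  Quotient.lift (fun p => shift p.1 p.2.2) (by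
    rintro p q ⟨y, γ, γ', h1, h2, h3, h4⟩
    rw [h1, h2, ← shift_mul, ← shift_mul, h3])

/-- The source `s [α, β, x] = β x`. -/
def src : PathGroupoid M → DirHered M :=
  Quotient.lift (fun p => shift p.2.1 p.2.2) (by
    rintro p q ⟨y, γ, γ', h1, h2, h3, h4⟩
    rw [h1, h2, ← shift_mul, ← shift_mul, h4])

@[simp] theorem rng_cls (α β : M) (x : DirHered M) : rng (cls α β x) = shift α x := rfl

@[simp] theorem src_cls (α β : M) (x : DirHered M) : src (cls α β x) = shift β x := rfl

/-- The inverse `[α, β, x]⁻¹ = [β, α, x]`. -/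
def inverse : PathGroupoid M → PathGroupoid M :=
  Quotient.lift (fun p => cls p.2.1 p.1 p.2.2) (by
    rintro p q ⟨y, γ, γ', h1, h2, h3, h4⟩
    exact cls_eq_iff.2 ⟨y, γ, γ', h1, h2, h4, h3⟩)

@[simp] theorem inverse_cls (α β : M) (x : DirHered M) :
    inverse (cls α β x) = cls β α x := rfl

/-- `k` is the product of `g` and `h`: `[α, β, ξ z] [γ, δ, η z] = [α ξ, δ η, z]` whenever
`β ξ = γ η`. -/
def IsProd (g h k : PathGroupoid M) : Prop :=
  ∃ (α β γ δ ξ η : M) (z : DirHered M), β * ξ = γ * η ∧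
    g = cls α β (shift ξ z) ∧ h = cls γ δ (shift η z) ∧ k = cls (α * ξ) (δ * η) z

theorem isProd_iff {g h k : PathGroupoid M} :
    IsProd g h k ↔ ∃ (α β δ : M) (z : DirHered M),
      g = cls α β z ∧ h = cls β δ z ∧ k = cls α δ z := by
  constructor
  · rintro ⟨α, β, γ, δ, ξ, η, z, e, rfl, rfl, rfl⟩
    exact ⟨α * ξ, β * ξ, δ * η, z, cls_shift _ _ _ _, by rw [cls_shift, e], rfl⟩
  · rintro ⟨α, β, δ, z, rfl, rfl, rfl⟩
    exact ⟨α, β, β, δ, 1, 1, z, rfl, by rw [shift_one], by rw [shift_one], by simp⟩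

theorem exists_isProd {g h : PathGroupoid M} (e : src g = rng h) : ∃ k, IsProd g h k := by
  obtain ⟨α, β, x, rfl⟩ := exists_cls g
  obtain ⟨γ, δ, y, rfl⟩ := exists_cls h
  obtain ⟨ξ, η, z, rfl, rfl, e'⟩ := exists_common e
  exact ⟨_, α, β, γ, δ, ξ, η, z, e', rfl, rfl, rfl⟩

theorem IsProd.unique {g h k k' : PathGroupoid M} (H : IsProd g h k) (H' : IsProd g h k') :
    k = k' := by
  obtain ⟨α, β, δ, z, rfl, rfl, rfl⟩ := isProd_iff.1 H
  obtain ⟨α', β', δ', z', h1, h2, rfl⟩ := isProd_iff.1 H'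
  obtain ⟨y, γ, γ', a1, a2, a3, a4⟩ := cls_eq_iff.1 h1
  obtain ⟨w, ε, ε', b1, b2, b3, b4⟩ := cls_eq_iff.1 h2
  dsimp only at a1 a2 a3 a4 b1 b2 b3 b4
  obtain ⟨ξ, η, u, hy, hw, e⟩ := exists_common (a1.symm.trans b1)
  have e' : γ' * ξ = ε' * η := mul_left_cancel (a := β') (by
    rw [← mul_assoc, ← a4, mul_assoc, e, ← mul_assoc, b3, mul_assoc])
  refine cls_eq_iff.2 ⟨u, γ * ξ, γ' * ξ, ?_, ?_, ?_, ?_⟩ <;> dsimp only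
  · rw [a1, hy, shift_mul]
  · rw [a2, hy, shift_mul]
  · rw [← mul_assoc, a3, mul_assoc]
  · rw [e, ← mul_assoc, b4, mul_assoc, e']

theorem IsProd.src_rng {g h k : PathGroupoid M} (H : IsProd g h k) :
    src g = rng h ∧ src k = src h ∧ rng k = rng g := by
  obtain ⟨α, β, δ, z, rfl, rfl, rfl⟩ := isProd_iff.1 H
  exact ⟨rfl, rfl, rfl⟩

/-- The product of a composable pair. -/
noncomputable def mulOf (g h : PathGroupoid M) (e : src g = rng h) : PathGroupoid M :=
  (exists_isProd e).choose

theorem mulOf_spec (g h : PathGroupoid M) (e : src g = rng h) : IsProd g h (mulOf g h e) :=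
  (exists_isProd e).choose_spec

theorem mulOf_eq {g h k : PathGroupoid M} (H : IsProd g h k) :
    mulOf g h H.src_rng.1 = k :=
  (mulOf_spec g h H.src_rng.1).unique H

theorem isProd_assoc {f g h fg gh k : PathGroupoid M} (h1 : IsProd f g fg) (h2 : IsProd g h gh)
    (h3 : IsProd fg h k) : IsProd f gh k := by
  obtain ⟨l, hl⟩ := exists_isProd (g := f) (h := gh) (by
    rw [h2.src_rng.2.2, h1.src_rng.1])
  obtain ⟨α, β, δ, z, rfl, hg, rfl⟩ := isProd_iff.1 h1
  obtain ⟨α', β', δ', z', hg', rfl, rfl⟩ := isProd_iff.1 h2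
  obtain ⟨w, ε, ε', b1, b2, b3, b4⟩ := cls_eq_iff.1 (hg.symm.trans hg')
  dsimp only at b1 b2 b3 b4
  subst b1 b2
  have hk : k = cls (α * ε) (δ' * ε') w := h3.unique
    ⟨α, δ, β', δ', ε, ε', w, b4, rfl, rfl, rfl⟩
  rw [hk]
  exact ⟨α, β, α', δ', ε, ε', w, b3, rfl, rfl, rfl⟩

/-- The groupoid of `M`, with unit space the set of directed hereditary subsets. -/
noncomputable instance : Groupoid (DirHered M) where
  Hom x y := {g : PathGroupoid M // src g = x ∧ rng g = y}
  id x := ⟨cls 1 1 x, shift_one x, shift_one x⟩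
  comp f g := ⟨mulOf g.1 f.1 (g.2.1.trans f.2.2.symm),
    (mulOf_spec _ _ _).src_rng.2.1.trans f.2.1, (mulOf_spec _ _ _).src_rng.2.2.trans g.2.2⟩
  inv f := ⟨inverse f.1, by
    obtain ⟨f, h, h'⟩ := f
    obtain ⟨α, β, x, rfl⟩ := exists_cls f
    exact ⟨h', h⟩⟩
  id_comp := by
    rintro x y ⟨f, h, h'⟩
    obtain ⟨α, β, z, rfl⟩ := exists_cls f
    subst h h'
    refine Subtype.ext (mulOf_eq ?_)
    exact ⟨α, β, 1, 1, 1, β, z, by simp, by rw [shift_one], rfl, by simp⟩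
  comp_id := by
    rintro x y ⟨f, h, h'⟩
    obtain ⟨α, β, z, rfl⟩ := exists_cls f
    subst h h'
    refine Subtype.ext (mulOf_eq ?_)
    exact ⟨1, 1, α, β, α, 1, z, by simp, rfl, by rw [shift_one], by simp⟩
  assoc := by
    rintro w x y z ⟨f, hf⟩ ⟨g, hg⟩ ⟨h, hh⟩
    refine Subtype.ext (mulOf_eq ?_)
    have e1 : src h = rng g := hh.1.trans hg.2.symm
    have e2 : src g = rng f := hg.1.trans hf.2.symm
    exact isProd_assoc (mulOf_spec h g e1) (mulOf_spec g f e2)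
      (mulOf_spec (mulOf h g e1) f ((mulOf_spec h g e1).src_rng.2.1.trans e2))
  inv_comp := by
    rintro x y ⟨f, h, h'⟩
    obtain ⟨α, β, z, rfl⟩ := exists_cls f
    subst h h'
    refine Subtype.ext (mulOf_eq ?_)
    exact isProd_iff.2 ⟨α, β, α, z, rfl, rfl, by
      simpa using (cls_shift 1 1 α z)⟩
  comp_inv := by
    rintro x y ⟨f, h, h'⟩
    obtain ⟨α, β, z, rfl⟩ := exists_cls f
    subst h h'
    refine Subtype.ext (mulOf_eq ?_)
    exact isProd_iff.2 ⟨β, α, β, z, rfl, rfl, by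
      simpa using (cls_shift 1 1 β z)⟩

/-- The topology of the groupoid, generated by the sets `[α, β, Ê] = {[α, β, x] : x ∈ Ê}`. -/
instance : TopologicalSpace (PathGroupoid M) :=
  TopologicalSpace.generateFrom
    {W | ∃ (α β γ : M) (F : Finset M), (∀ δ ∈ F, γ ∣ δ ∧ δ ≠ γ) ∧
      W = cls α β '' hat (basicSet γ F)}

/-- The restriction of the groupoid to the boundary: all elements whose source and range lie in the
boundary. -/
noncomputable instance boundaryGroupoid : Groupoid (boundary M) where
  Hom x y := (x : DirHered M) ⟶ (y : DirHered M)
  id x := 𝟙 (x : DirHered M)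
  comp f g := CategoryStruct.comp (obj := DirHered M) f g
  inv f := Groupoid.inv (obj := DirHered M) f
  id_comp f := Category.id_comp (obj := DirHered M) f
  comp_id f := Category.comp_id (obj := DirHered M) f
  assoc f g h := Category.assoc (obj := DirHered M) f g h
  inv_comp f := Groupoid.inv_comp (obj := DirHered M) f
  comp_inv f := Groupoid.comp_inv (obj := DirHered M) f

/-- The underlying element of the whole groupoid. -/
def boundaryElement (g : Quiver.Total (boundary M)) : PathGroupoid M :=
  Subtype.val (p := fun k : PathGroupoid M => src k = g.left.1 ∧ rng k = g.right.1) g.hom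

/-- The restriction to the boundary carries the subspace topology. -/
instance : TopologicalSpace (Quiver.Total (boundary M)) :=
  TopologicalSpace.induced boundaryElement inferInstance

end DirHered

/-! ## Baumslag-Solitar groups -/

/-- The two generators. -/
inductive BSGen
  | a
  | b

/-- The Baumslag-Solitar group `⟨a, b | a b ^ c = b ^ e a⟩`. -/
abbrev BSGroup (c e : ℤ) : Type :=
  PresentedGroup ({FreeGroup.of BSGen.a * FreeGroup.of BSGen.b ^ c *
    (FreeGroup.of BSGen.b ^ e * FreeGroup.of BSGen.a)⁻¹} : Set (FreeGroup BSGen))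

/-- The submonoid of the Baumslag-Solitar group generated by `a` and `b`. -/
def bsMonoid (c e : ℤ) : Submonoid (BSGroup c e) :=
  Submonoid.closure {PresentedGroup.of BSGen.a, PresentedGroup.of BSGen.b}

/-! Every element of the monoid is uniquely `b ^ i₁ a ⋯ b ^ iₖ a b ^ m` with `0 ≤ iⱼ < d` and `m` an
integer, possibly negative. Existence is Euclidean division by `d`: a power `b ^ (d q)` crosses `a`
and becomes `b ^ (± c q)`. Uniqueness (`BSGroup.normalForm_injective`) is Britton's lemma in an HNN
extension of the integers.

Forgetting `m` leaves a word in `d` letters, unchanged by right multiplication by `b`. If the word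
of `α` is a prefix of the word of `γ`, then `α` divides `γ b ^ N` for some `N`. So, up to powers of
`b`, divisibility is the prefix order of the `d`-ary tree. Maximal directed hereditary sets
therefore correspond to infinite words. They already form a closed set, so the boundary is the space
of infinite words with its cylinder topology (`WordMap.boundary_eq_range_point`). The dynamical
arguments use only the axioms of `WordMap`.

Translation by `α` maps the whole boundary into the cylinder of `α`. This gives minimality and, when
`d > 1`, contractivity; when `d = 1` the boundary is a single point.

Topological freeness depends on whether left multiplication by a power of `b` can preserve all
words. If `d ∣ c`, then `b ^ d` does, and it gives nontrivial isotropy at every unit. Conversely, if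
`b ^ p` with `p ≠ 0` does, then `d ^ n ∣ p c ^ n` for all `n`, which forces `d ∣ c`. So if `d ∤ c`,
the solutions of `α y = β y` with `α ≠ β` give closed sets with empty interior
(`WordMap.dense_compl_fixedWords`), and Baire's theorem over the countably many pairs finishes the
proof. -/

/-! ## Normal forms in Baumslag-Solitar groups -/

section NormalForm

variable {G : Type*} [Group G]

/-- The element `b ^ i₁ a b ^ i₂ a ⋯ b ^ iₖ a b ^ m`. -/
def normalForm (a b : G) {d : ℕ} (w : List (Fin d)) (m : ℤ) : G :=
  (w.map fun i : Fin d => b ^ ((i : ℕ) : ℤ) * a).prod * b ^ m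

variable {a b : G} {d : ℕ}

@[simp] theorem normalForm_nil (m : ℤ) : normalForm a b ([] : List (Fin d)) m = b ^ m := by
  simp [normalForm]

theorem normalForm_cons (i : Fin d) (w : List (Fin d)) (m : ℤ) :
    normalForm a b (i :: w) m = b ^ ((i : ℕ) : ℤ) * a * normalForm a b w m := by
  simp [normalForm, mul_assoc]

theorem normalForm_mul_zpow (w : List (Fin d)) (m n : ℤ) :
    normalForm a b w m * b ^ n = normalForm a b w (m + n) := by
  simp [normalForm, mul_assoc, zpow_add]

theorem normalForm_zero_mul (v w : List (Fin d)) (m : ℤ) :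
    normalForm a b v 0 * normalForm a b w m = normalForm a b (v ++ w) m := by
  simp [normalForm, mul_assoc]

theorem zpow_mul_comm_of_rel {c e : ℤ} (h : a * b ^ c = b ^ e * a) (k : ℤ) :
    b ^ (e * k) * a = a * b ^ (c * k) := by
  have h' : a * b ^ c * a⁻¹ = b ^ e := by rw [h]; group
  rw [zpow_mul, zpow_mul, ← h', conj_zpow]
  group

/-- Moving the sign `σ = ±1` to the exponent of the right-hand side treats both families of groups
at once, with the positive divisor `d`. -/
theorem zpow_natCast_mul_comm_of_rel {c e σ : ℤ} (h : a * b ^ c = b ^ e * a)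
    (hσ : σ * σ = 1) (he : e = σ * d) (k : ℤ) :
    b ^ ((d : ℤ) * k) * a = a * b ^ (σ * c * k) := by
  have := zpow_mul_comm_of_rel h (σ * k)
  rw [he, show σ * d * (σ * k) = σ * σ * (d * k) by ring, hσ, one_mul] at this
  rw [this]
  ring_nf

/-- Division with carry: the remainder of `p + i` modulo `d` is the new letter, and the quotient `q`
passes `b ^ (σ c q)` on to the next letter. The carry never sees `m`, so `w'` and `t` do not depend
on it. -/
theorem exists_zpow_mul_normalForm {c e σ : ℤ} (h : a * b ^ c = b ^ e * a)
    (hσ : σ * σ = 1) (he : e = σ * d) (hd : 0 < d) (w : List (Fin d)) (p : ℤ) :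
    ∃ (w' : List (Fin d)) (t : ℤ), w'.length = w.length ∧
      ∀ m, b ^ p * normalForm a b w m = normalForm a b w' (t + m) := by
  induction w generalizing p with
  | nil => exact ⟨[], p, rfl, fun m => by simp [zpow_add]⟩
  | cons i w ih =>
    have hd' : (0 : ℤ) < d := by exact_mod_cast hd
    set q := (p + (i : ℕ)) / (d : ℤ) with hq
    set r := (p + (i : ℕ)) % (d : ℤ) with hr
    have hr0 : 0 ≤ r := Int.emod_nonneg _ hd'.ne'
    have hr1 : r < d := Int.emod_lt_of_pos _ hd'
    obtain ⟨w', t, hl, hw⟩ := ih (σ * c * q)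
    refine ⟨⟨r.toNat, by omega⟩ :: w', t, by simp [hl], fun m => ?_⟩
    rw [normalForm_cons, normalForm_cons, ← hw, ← mul_assoc, ← mul_assoc, ← mul_assoc,
      ← zpow_add]
    congr 1
    have e1 : p + (i : ℕ) = r + d * q := (Int.emod_add_mul_ediv _ _).symm
    have e2 : (((⟨r.toNat, by omega⟩ : Fin d) : ℕ) : ℤ) = r := by simp [hr0]
    rw [e1, e2, zpow_add, mul_assoc, mul_assoc, zpow_natCast_mul_comm_of_rel h hσ he]

theorem exists_normalForm_mul {c e σ : ℤ} (h : a * b ^ c = b ^ e * a)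
    (hσ : σ * σ = 1) (he : e = σ * d) (hd : 0 < d) (v w : List (Fin d)) (p : ℤ) :
    ∃ (w' : List (Fin d)) (t : ℤ), w'.length = w.length ∧
      ∀ m, normalForm a b v p * normalForm a b w m = normalForm a b (v ++ w') (t + m) := by
  obtain ⟨w', t, hl, hw⟩ := exists_zpow_mul_normalForm h hσ he hd w p
  refine ⟨w', t, hl, fun m => ?_⟩
  rw [← normalForm_zero_mul, ← hw, ← mul_assoc, normalForm_mul_zpow, zero_add]

/-- When `d ∣ c` the carry is again a multiple of `d`, so no letter ever changes. -/
theorem exists_zpow_mul_normalForm_of_dvd {c e σ : ℤ} (h : a * b ^ c = b ^ e * a)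
    (hσ : σ * σ = 1) (he : e = σ * d) (hdc : (d : ℤ) ∣ c) (w : List (Fin d)) (k : ℤ) :
    ∃ t : ℤ, ∀ m, b ^ ((d : ℤ) * k) * normalForm a b w m = normalForm a b w (t + m) := by
  induction w generalizing k with
  | nil => exact ⟨d * k, fun m => by simp [zpow_add]⟩
  | cons i w ih =>
    obtain ⟨q, rfl⟩ := hdc
    obtain ⟨t, ht⟩ := ih (σ * q * k)
    refine ⟨t, fun m => ?_⟩
    rw [normalForm_cons, normalForm_cons, ← ht, ← mul_assoc, ← mul_assoc, ← zpow_add, add_comm,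
      zpow_add, mul_assoc (b ^ _), zpow_natCast_mul_comm_of_rel h hσ he]
    rw [show σ * (d * q) * k = d * (σ * q * k) by ring]
    group

end NormalForm

/-! ### Britton's lemma for words positive in the stable letter -/

namespace HNNExtension

variable {G : Type*} [Group G] {A B : Subgroup G} {φ : A ≃* B}

/-- The reduced word `g t g₁ t g₂ ⋯ t gₙ`. -/
def positiveWord (A B : Subgroup G) (g : G) (l : List G) : NormalWord.ReducedWord G A B where
  head := g
  toList := l.map fun x => (1, x)
  chain := by
    rw [List.isChain_map]
    induction l with
    | nil => exact List.isChain_nil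
    | cons x l ih =>
      cases l with
      | nil => exact List.isChain_singleton _
      | cons y l => exact List.isChain_cons_cons.2 ⟨fun _ => rfl, ih⟩

theorem prod_positiveWord (g : G) (l : List G) :
    (positiveWord A B g l).prod φ = of g * (l.map fun x => t * of x).prod := by
  simp [positiveWord, NormalWord.ReducedWord.prod, Function.comp_def]

theorem length_eq_of_positiveWord {g g' : G} {l l' : List G}
    (h : of g * (l.map fun x => (t : HNNExtension G A B φ) * of x).prod =
      of g' * (l'.map fun x => t * of x).prod) :
    l.length = l'.length ∧ (l ≠ [] → g⁻¹ * g' ∈ B) := by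
  rw [← prod_positiveWord, ← prod_positiveWord] at h
  obtain ⟨h1, h2⟩ := ReducedWord.map_fst_eq_and_of_prod_eq φ h
  refine ⟨by simpa [positiveWord] using congrArg List.length h1, fun hl => ?_⟩
  cases l with
  | nil => exact absurd rfl hl
  | cons x l => simpa [positiveWord] using h2 1 (by simp [positiveWord])

/-- Britton's lemma determines the coset of the first letter modulo `B`, hence that letter; cancel
it and induct. -/
theorem map_positive_injective {d : ℕ} {r : Fin d → G} (hr : ∀ i j, (r i)⁻¹ * r j ∈ B → i = j)
    {w w' : List (Fin d)} {g g' : G}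
    (h : (w.map fun i => (of (r i) : HNNExtension G A B φ) * t).prod * of g =
      (w'.map fun i => of (r i) * t).prod * of g') : w = w' ∧ g = g' := by
  -- Regrouping each `t` with the base element to its right gives a positive word; its head is the
  -- first letter, or `g` if there is none.
  have key : ∀ (w : List (Fin d)) (g : G), ∃ l : List G, l.length = w.length ∧
      (w.map fun i => (of (r i) : HNNExtension G A B φ) * t).prod * of g =
        of ((w.map r).headD g) * (l.map fun x => t * of x).prod := by
    intro w g
    induction w with
    | nil => exact ⟨[], rfl, by simp⟩
    | cons j w ih =>
      obtain ⟨l, hl, e⟩ := ih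
      exact ⟨(w.map r).headD g :: l, by simp [hl], by
        simp only [List.map_cons, List.prod_cons, mul_assoc, List.headD_cons] at e ⊢
        rw [e]⟩
  have base : ∀ (w : List (Fin d)) (g g' : G),
      (w.map fun i => (of (r i) : HNNExtension G A B φ) * t).prod * of g = of g' → w = [] := by
    intro w g g' h
    rcases w with _ | ⟨i, w⟩
    · rfl
    · obtain ⟨l, hl, e⟩ := key (i :: w) g
      rw [h] at e
      have := (length_eq_of_positiveWord (l := []) (g := g') (by simpa using e)).1
      simp [hl] at this
  induction w generalizing w' with
  | nil =>
    obtain rfl := base w' g' g (by simpa using h.symm)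
    exact ⟨rfl, of_injective φ (by simpa using h)⟩
  | cons i w ih =>
    rcases w' with _ | ⟨j, w'⟩
    · exact absurd (base _ _ _ (h.trans (by simp; rfl))) (by simp)
    · obtain ⟨l, hl, e⟩ := key (i :: w) g
      obtain ⟨l', hl', e'⟩ := key (j :: w') g'
      have := (length_eq_of_positiveWord (e.symm.trans (h.trans e'))).2 (by
        rintro rfl; simp at hl)
      obtain rfl := hr i j (by simpa using this)
      obtain ⟨rfl, hg⟩ := ih (w' := w') (by
        simp only [List.map_cons, List.prod_cons, mul_assoc] at h
        exact mul_left_cancel (mul_left_cancel h))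
      exact ⟨rfl, hg⟩

end HNNExtension

/-! ### Uniqueness of the normal form -/

namespace BSGroup

variable {c e : ℤ}

/-- The stable letter. -/
def genA (c e : ℤ) : BSGroup c e := PresentedGroup.of BSGen.a

/-- The generator of the base group. -/
def genB (c e : ℤ) : BSGroup c e := PresentedGroup.of BSGen.b

theorem genA_mul_genB_zpow (c e : ℤ) :
    genA c e * genB c e ^ c = genB c e ^ e * genA c e := by
  have h := PresentedGroup.one_of_mem (rels := {FreeGroup.of BSGen.a * FreeGroup.of BSGen.b ^ c *
    (FreeGroup.of BSGen.b ^ e * FreeGroup.of BSGen.a)⁻¹}) (Set.mem_singleton _)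
  rw [map_mul, map_inv, mul_inv_eq_one, map_mul, map_mul, map_zpow, map_zpow] at h
  exact h

/-- Multiplication by `n` on the infinite cyclic group. -/
def mulHom (n : ℤ) : Multiplicative ℤ →* Multiplicative ℤ :=
  AddMonoidHom.toMultiplicative (AddMonoidHom.mulLeft n)

theorem mulHom_apply (n k : ℤ) :
    mulHom n (Multiplicative.ofAdd k) = Multiplicative.ofAdd (n * k) := rfl

theorem mulHom_injective {n : ℤ} (hn : n ≠ 0) : Function.Injective (mulHom n) := by
  intro x y h
  exact Multiplicative.toAdd.injective (mul_left_cancel₀ hn (congrArg Multiplicative.toAdd h))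

/-- The isomorphism `cℤ ≃ eℤ`, `c ↦ e`. -/
noncomputable def rangeEquiv (hc : c ≠ 0) (he : e ≠ 0) : (mulHom c).range ≃* (mulHom e).range :=
  (MonoidHom.ofInjective (mulHom_injective hc)).symm.trans
    (MonoidHom.ofInjective (mulHom_injective he))

theorem coe_ofInjective_mulHom {n : ℤ} (hn : n ≠ 0) :
    ((MonoidHom.ofInjective (mulHom_injective hn) (Multiplicative.ofAdd 1) :
      (mulHom n).range) : Multiplicative ℤ) = Multiplicative.ofAdd n := by
  rw [MonoidHom.ofInjective_apply, mulHom_apply, mul_one]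

theorem rangeEquiv_apply (hc : c ≠ 0) (he : e ≠ 0) :
    rangeEquiv hc he (MonoidHom.ofInjective (mulHom_injective hc) (Multiplicative.ofAdd 1)) =
      MonoidHom.ofInjective (mulHom_injective he) (Multiplicative.ofAdd 1) := by
  rw [rangeEquiv, MulEquiv.trans_apply, MulEquiv.symm_apply_apply]

/-- A homomorphism is enough: normal forms that are told apart by their images are distinct. -/
theorem exists_hom_HNNExtension (hc : c ≠ 0) (he : e ≠ 0) :
    ∃ f : BSGroup c e →* HNNExtension (Multiplicative ℤ) _ _ (rangeEquiv hc he),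
      f (genA c e) = HNNExtension.t ∧
        ∀ k : ℤ, f (genB c e ^ k) = HNNExtension.of (Multiplicative.ofAdd k) := by
  let F : BSGen → HNNExtension (Multiplicative ℤ) _ _ (rangeEquiv hc he) := fun x =>
    match x with
    | BSGen.a => HNNExtension.t
    | BSGen.b => HNNExtension.of (Multiplicative.ofAdd 1)
  have hk : ∀ k : ℤ, F BSGen.b ^ k = HNNExtension.of (Multiplicative.ofAdd k) := fun k => by
    simp only [F]
    rw [← map_zpow, ← ofAdd_zsmul, smul_eq_mul, mul_one]
  have h := HNNExtension.t_mul_of (φ := rangeEquiv hc he)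
    (MonoidHom.ofInjective (mulHom_injective hc) (Multiplicative.ofAdd 1))
  rw [rangeEquiv_apply, coe_ofInjective_mulHom hc, coe_ofInjective_mulHom he] at h
  have hF : ∀ r ∈ ({FreeGroup.of BSGen.a * FreeGroup.of BSGen.b ^ c *
      (FreeGroup.of BSGen.b ^ e * FreeGroup.of BSGen.a)⁻¹} : Set (FreeGroup BSGen)),
      FreeGroup.lift F r = 1 := by
    rintro _ rfl
    simp only [map_mul, map_inv, map_zpow, FreeGroup.lift_apply_of, mul_inv_eq_one, hk]
    exact h
  exact ⟨PresentedGroup.toGroup hF, PresentedGroup.toGroup.of hF, fun k =>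
    (map_zpow _ _ _).trans ((congrArg (· ^ k) (PresentedGroup.toGroup.of hF)).trans (hk k))⟩

/-- The exponents `0, …, d - 1` lie in distinct cosets of `eℤ = dℤ`, so the statement for HNN
extensions applies. -/
theorem normalForm_injective {d : ℕ} {σ : ℤ} (hc : c ≠ 0) (hd : 0 < d) (hσ : σ * σ = 1)
    (he : e = σ * d) {w w' : List (Fin d)} {m m' : ℤ}
    (h : normalForm (genA c e) (genB c e) w m = normalForm (genA c e) (genB c e) w' m') :
    w = w' ∧ m = m' := by
  have he0 : e ≠ 0 := by
    rintro rfl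
    rcases mul_eq_zero.1 he.symm with h | h
    · simp [h] at hσ
    · exact hd.ne' (by exact_mod_cast h)
  obtain ⟨f, hA, hB⟩ := exists_hom_HNNExtension hc he0
  have key : ∀ (w : List (Fin d)) (m : ℤ), f (normalForm (genA c e) (genB c e) w m) =
      (w.map fun i : Fin d => HNNExtension.of (Multiplicative.ofAdd ((i : ℕ) : ℤ)) *
        HNNExtension.t).prod * HNNExtension.of (Multiplicative.ofAdd m) := by
    intro w m
    simp only [normalForm, map_mul, map_list_prod, List.map_map, hB, Function.comp_def, hA]
  have h' := congrArg f h
  rw [key, key] at h'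
  have := HNNExtension.map_positive_injective
    (r := fun i : Fin d => Multiplicative.ofAdd ((i : ℕ) : ℤ)) ?_ h'
  · exact ⟨this.1, Multiplicative.ofAdd.injective this.2⟩
  · rintro i j ⟨k, hk⟩
    have hk' : e * k.toAdd = -((i : ℕ) : ℤ) + ((j : ℕ) : ℤ) := congrArg Multiplicative.toAdd hk
    have hdvd : (d : ℤ) ∣ ((j : ℕ) : ℤ) - ((i : ℕ) : ℤ) := ⟨σ * k.toAdd, by rw [he] at hk'; linarith⟩
    have := Int.eq_zero_of_abs_lt_dvd hdvd (by rw [abs_lt]; omega)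
    exact Fin.ext (by omega)

end BSGroup

/-- A monoid whose elements carry a word in `d` letters, up to right multiplication by powers of a
base element: `α` divides `γ * base ^ N` for some `N` if the word of `α` is a prefix of the word of
`γ`. -/
structure WordMap (M : Type*) [Monoid M] (d : ℕ) where
  word : M → List (Fin d)
  base : M
  letter : Fin d → M
  length_word_mul : ∀ α β, (word (α * β)).length = (word α).length + (word β).length
  word_prefix_mul : ∀ α β, word α <+: word (α * β)
  word_mul_base : ∀ α, word (α * base) = word α
  exists_dvd : ∀ α γ, word α <+: word γ → ∃ N : ℕ, α ∣ γ * base ^ N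
  length_word_letter : ∀ j, (word (letter j)).length = 1
  exists_letter : ∀ α i, ∃ j, word (α * letter j) = word α ++ [i]

/-! ### The word map of the monoid, and which elements it separates -/

namespace BSGroup

variable {c e : ℤ} {d : ℕ} {σ : ℤ}

theorem genB_zpow_mem (c e : ℤ) {m : ℤ} (hm : 0 ≤ m) : genB c e ^ m ∈ bsMonoid c e := by
  obtain ⟨n, rfl⟩ := Int.eq_ofNat_of_zero_le hm
  rw [zpow_natCast]
  exact pow_mem (Submonoid.subset_closure (by simp [genB])) n

theorem genA_mem (c e : ℤ) : genA c e ∈ bsMonoid c e :=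
  Submonoid.subset_closure (by simp [genA])

theorem normalForm_mem (c e : ℤ) (w : List (Fin d)) {m : ℤ} (hm : 0 ≤ m) :
    normalForm (genA c e) (genB c e) w m ∈ bsMonoid c e := by
  refine mul_mem (Submonoid.list_prod_mem _ ?_) (genB_zpow_mem c e hm)
  intro x hx
  obtain ⟨i, -, rfl⟩ := List.mem_map.1 hx
  exact mul_mem (genB_zpow_mem c e (Int.natCast_nonneg _)) (genA_mem c e)

theorem genA_eq_normalForm (hd : 0 < d) :
    genA c e = normalForm (genA c e) (genB c e) [(⟨0, hd⟩ : Fin d)] 0 := by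
  simp [normalForm]

theorem exists_eq_normalForm (hd : 0 < d) (hσ : σ * σ = 1) (he : e = σ * d)
    (x : bsMonoid c e) :
    ∃ (w : List (Fin d)) (m : ℤ), (x : BSGroup c e) = normalForm (genA c e) (genB c e) w m := by
  obtain ⟨x, hx⟩ := x
  induction hx using Submonoid.closure_induction with
  | mem x hx =>
    rcases hx with rfl | rfl
    · exact ⟨_, _, genA_eq_normalForm hd⟩
    · exact ⟨[], 1, by simp [genB]⟩
  | one => exact ⟨[], 0, by simp⟩
  | mul x y _ _ hx hy =>
    obtain ⟨v, p, hv⟩ := hx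
    obtain ⟨w, m, hw⟩ := hy
    obtain ⟨w', t, -, h⟩ := exists_normalForm_mul (genA_mul_genB_zpow c e) hσ he hd v w p
    exact ⟨v ++ w', t + m, by rw [← h, ← hv, ← hw]⟩

/-- The word of an element of the monoid. -/
noncomputable def word (hd : 0 < d) (hσ : σ * σ = 1) (he : e = σ * d) (x : bsMonoid c e) :
    List (Fin d) :=
  (exists_eq_normalForm hd hσ he x).choose

theorem exists_eq_normalForm_word (hd : 0 < d) (hσ : σ * σ = 1) (he : e = σ * d)
    (x : bsMonoid c e) :
    ∃ m, (x : BSGroup c e) = normalForm (genA c e) (genB c e) (word hd hσ he x) m :=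
  (exists_eq_normalForm hd hσ he x).choose_spec

theorem word_eq (hc : c ≠ 0) (hd : 0 < d) (hσ : σ * σ = 1) (he : e = σ * d)
    {x : bsMonoid c e} {w : List (Fin d)} {m : ℤ}
    (h : (x : BSGroup c e) = normalForm (genA c e) (genB c e) w m) : word hd hσ he x = w := by
  obtain ⟨m', h'⟩ := exists_eq_normalForm_word hd hσ he x
  exact (normalForm_injective hc hd hσ he (h'.symm.trans h)).1

theorem exists_word_mul (hc : c ≠ 0) (hd : 0 < d) (hσ : σ * σ = 1) (he : e = σ * d)
    (x y : bsMonoid c e) : ∃ w', w'.length = (word hd hσ he y).length ∧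
      word hd hσ he (x * y) = word hd hσ he x ++ w' := by
  obtain ⟨p, hp⟩ := exists_eq_normalForm_word hd hσ he x
  obtain ⟨m, hm⟩ := exists_eq_normalForm_word hd hσ he y
  obtain ⟨w', t, hl, h⟩ := exists_normalForm_mul (genA_mul_genB_zpow c e) hσ he hd
    (word hd hσ he x) (word hd hσ he y) p
  exact ⟨w', hl, word_eq hc hd hσ he (m := t + m) (by
    rw [← h, ← hp, ← hm, Submonoid.coe_mul])⟩

theorem exists_dvd_of_word_prefix (hd : 0 < d) (hσ : σ * σ = 1) (he : e = σ * d)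
    (x y : bsMonoid c e) (h : word hd hσ he x <+: word hd hσ he y) :
    ∃ N : ℕ, x ∣ y * (⟨genB c e, by simpa using genB_zpow_mem c e zero_le_one⟩ : bsMonoid c e) ^ N
    := by
  obtain ⟨u, hu⟩ := h
  obtain ⟨p, hp⟩ := exists_eq_normalForm_word hd hσ he x
  obtain ⟨m, hm⟩ := exists_eq_normalForm_word hd hσ he y
  obtain ⟨u', t, -, h⟩ := exists_zpow_mul_normalForm (genA_mul_genB_zpow c e) hσ he hd u (-p)
  -- This makes the final exponent `t + m + N` nonnegative, so that the quotient lies in the monoid.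
  set N := (t + m).natAbs
  refine ⟨N, ⟨_, normalForm_mem c e u' (m := t + (m + N)) (by omega)⟩, Subtype.ext ?_⟩
  simp only [Submonoid.coe_mul, SubmonoidClass.coe_pow]
  rw [← h, hp, hm, ← zpow_natCast, normalForm_mul_zpow, ← mul_assoc, normalForm_mul_zpow,
    add_neg_cancel, normalForm_zero_mul, hu]

theorem exists_letter (hc : c ≠ 0) (hd : 0 < d) (hσ : σ * σ = 1) (he : e = σ * d)
    (x : bsMonoid c e) (i : Fin d) : ∃ j : Fin d,
      word hd hσ he (x * ⟨normalForm (genA c e) (genB c e) [j] 0, normalForm_mem c e _ le_rfl⟩) =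
        word hd hσ he x ++ [i] := by
  have hd' : (0 : ℤ) < d := by exact_mod_cast hd
  obtain ⟨p, hp⟩ := exists_eq_normalForm_word hd hσ he x
  have h0 := Int.emod_nonneg ((i : ℕ) - p) hd'.ne'
  have h1 := Int.emod_lt_of_pos ((i : ℕ) - p) hd'
  have h2 := Int.emod_add_mul_ediv ((i : ℕ) - p) d
  set q := ((i : ℕ) - p) / (d : ℤ)
  set r := ((i : ℕ) - p) % (d : ℤ)
  -- The letter is the remainder of `i - p`: then `p + r = i - d q`, and `b ^ (-d q)` crosses `a`.
  refine ⟨⟨r.toNat, by omega⟩, word_eq hc hd hσ he (m := σ * c * -q) ?_⟩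
  have e2 : (((⟨r.toNat, by omega⟩ : Fin d) : ℕ) : ℤ) = r := by simp [h0]
  have e3 : normalForm (genA c e) (genB c e) (word hd hσ he x) p =
      normalForm (genA c e) (genB c e) (word hd hσ he x) 0 * genB c e ^ p := by
    rw [normalForm_mul_zpow, zero_add]
  rw [Submonoid.coe_mul, hp, e3, mul_assoc, ← normalForm_zero_mul]
  congr 1
  show _ * normalForm (genA c e) (genB c e) [(⟨r.toNat, by omega⟩ : Fin d)] 0 = _
  rw [normalForm_cons, normalForm_cons, e2, normalForm_nil, normalForm_nil, zpow_zero, mul_one,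
    mul_assoc (genB c e ^ _) (genA c e) (genB c e ^ _),
    ← zpow_natCast_mul_comm_of_rel (genA_mul_genB_zpow c e) hσ he, ← mul_assoc,
    ← mul_assoc, ← zpow_add, ← zpow_add]
  congr 2
  linarith

/-- The words of the elements of the monoid generated by `a` and `b`. -/
noncomputable def wordMap (hc : c ≠ 0) (hd : 0 < d) (hσ : σ * σ = 1) (he : e = σ * d) :
    WordMap (bsMonoid c e) d where
  word := word hd hσ he
  base := ⟨genB c e, by simpa using genB_zpow_mem c e zero_le_one⟩
  letter j := ⟨normalForm (genA c e) (genB c e) [j] 0, normalForm_mem c e _ le_rfl⟩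
  length_word_mul x y := by
    obtain ⟨w, hl, h⟩ := exists_word_mul hc hd hσ he x y
    rw [h, List.length_append, hl]
  word_prefix_mul x y := by
    obtain ⟨w, hl, h⟩ := exists_word_mul hc hd hσ he x y
    exact ⟨w, h.symm⟩
  word_mul_base x := by
    obtain ⟨p, hp⟩ := exists_eq_normalForm_word hd hσ he x
    refine word_eq hc hd hσ he (m := p + 1) ?_
    have h := normalForm_mul_zpow (a := genA c e) (b := genB c e) (word hd hσ he x) p 1
    rw [← hp, zpow_one] at h
    exact h
  exists_dvd := exists_dvd_of_word_prefix hd hσ he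
  length_word_letter j := by
    rw [word_eq hc hd hσ he rfl, List.length_singleton]
  exists_letter := exists_letter hc hd hσ he

theorem exists_ne_one_word_mul (hc : c ≠ 0) (hd : 0 < d) (hσ : σ * σ = 1) (he : e = σ * d)
    (hdc : (d : ℤ) ∣ c) : ∃ z : bsMonoid c e, z ≠ 1 ∧ ∀ y,
      (wordMap hc hd hσ he).word (z * y) = (wordMap hc hd hσ he).word y := by
  refine ⟨⟨genB c e ^ ((d : ℤ) * 1), genB_zpow_mem c e (by omega)⟩, fun h => ?_, fun y => ?_⟩
  · have h' : normalForm (genA c e) (genB c e) ([] : List (Fin d)) ((d : ℤ) * 1) =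
        normalForm (genA c e) (genB c e) ([] : List (Fin d)) 0 := by
      rw [normalForm_nil, normalForm_nil, zpow_zero]
      exact congrArg Subtype.val h
    have := (normalForm_injective hc hd hσ he h').2
    omega
  · obtain ⟨m, hm⟩ := exists_eq_normalForm_word hd hσ he y
    obtain ⟨t, h⟩ := exists_zpow_mul_normalForm_of_dvd (genA_mul_genB_zpow c e) hσ he hdc
      (word hd hσ he y) 1
    exact word_eq hc hd hσ he (m := t + m) ((congrArg _ hm).trans (h m))

/-- The one-letter word `0` detects `p` modulo `d`. Words starting with `0`, after cancelling `a`,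
give the same hypothesis for the carry `σ c q`, so the argument can be iterated. -/
theorem dvd_of_forall_zpow_mul_normalForm (hc : c ≠ 0) (hd : 0 < d) (hσ : σ * σ = 1)
    (he : e = σ * d) {p : ℤ} (h : ∀ w : List (Fin d), ∃ t, genB c e ^ p *
      normalForm (genA c e) (genB c e) w 0 = normalForm (genA c e) (genB c e) w t) :
    ∃ q, p = d * q ∧ ∀ w : List (Fin d), ∃ t, genB c e ^ (σ * c * q) *
      normalForm (genA c e) (genB c e) w 0 = normalForm (genA c e) (genB c e) w t := by
  have hd' : (0 : ℤ) < d := by exact_mod_cast hd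
  have hdvd : (d : ℤ) ∣ p := by
    have h0 := Int.emod_nonneg p hd'.ne'
    have h1 := Int.emod_lt_of_pos p hd'
    have h2 := Int.emod_add_mul_ediv p d
    set q := p / (d : ℤ)
    set r := p % (d : ℤ) with hr
    obtain ⟨t, ht⟩ := h [⟨0, hd⟩]
    have e2 : (((⟨r.toNat, by omega⟩ : Fin d) : ℕ) : ℤ) = r := by simp [h0]
    have h3 : normalForm (genA c e) (genB c e) [(⟨r.toNat, by omega⟩ : Fin d)] (σ * c * q) =
        normalForm (genA c e) (genB c e) [⟨0, hd⟩] t := by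
      rw [← ht, ← genA_eq_normalForm, normalForm_cons, e2, normalForm_nil, mul_assoc,
        ← zpow_natCast_mul_comm_of_rel (genA_mul_genB_zpow c e) hσ he, ← mul_assoc, ← zpow_add, h2]
    have h4 := (normalForm_injective hc hd hσ he h3).1
    simp only [List.cons.injEq, Fin.mk.injEq, and_true] at h4
    exact Int.dvd_of_emod_eq_zero (by omega)
  obtain ⟨q, rfl⟩ := hdvd
  refine ⟨q, rfl, fun w => ?_⟩
  obtain ⟨t, ht⟩ := h (⟨0, hd⟩ :: w)
  refine ⟨t, mul_left_cancel (a := genA c e) ?_⟩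
  simpa [normalForm_cons, ← mul_assoc,
    zpow_natCast_mul_comm_of_rel (genA_mul_genB_zpow c e) hσ he] using ht

/-- After division by `gcd (d, c)`, every power of the cofactor `d'` of `d` is coprime to the
cofactor of `c` and so divides `p`; hence `d' = 1`. -/
theorem dvd_of_forall_pow_dvd {c p : ℤ} (hp : p ≠ 0) (hd : 0 < d)
    (h : ∀ n : ℕ, (d : ℤ) ^ n ∣ p * c ^ n) : (d : ℤ) ∣ c := by
  obtain ⟨g, d', c', hg, hcop, h1, h2⟩ :=
    Int.exists_gcd_one' (m := (d : ℤ)) (n := c) (Int.gcd_pos_of_ne_zero_left _ (by omega))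
  have hu : ∀ n : ℕ, d' ^ n ∣ p := fun n => by
    have := h n
    rw [h1, h2, mul_pow, mul_pow, ← mul_assoc] at this
    have h3 := Int.dvd_of_mul_dvd_mul_right (by positivity) this
    exact (IsCoprime.pow (Int.isCoprime_iff_gcd_eq_one.2 hcop)).dvd_of_dvd_mul_right h3
  have hd' : 0 < d' := by
    have : (0 : ℤ) < d' * g := by rw [← h1]; exact_mod_cast hd
    exact pos_of_mul_pos_left this (by positivity)
  obtain rfl : d' = 1 := by
    by_contra hne
    have h5 : p.natAbs < d'.natAbs ^ p.natAbs := Nat.lt_pow_self (by omega)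
    have h6 := Nat.le_of_dvd (by omega) (Int.natAbs_dvd_natAbs.2 (hu p.natAbs))
    rw [Int.natAbs_pow] at h6
    omega
  rw [h1, h2]
  exact mul_dvd_mul_right (one_dvd _) _

/-- If no `z` separates them, `x` and `y` have the same word and differ by a power `b ^ (p - q)`
that preserves all words. Iterating the carry gives `d ^ n ∣ (p - q) c ^ n` for all `n`. -/
theorem exists_word_mul_ne (hc : c ≠ 0) (hd : 0 < d) (hσ : σ * σ = 1) (he : e = σ * d)
    (hdc : ¬ (d : ℤ) ∣ c) {x y : bsMonoid c e} (hxy : x ≠ y) : ∃ z,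
      (wordMap hc hd hσ he).word (x * z) ≠ (wordMap hc hd hσ he).word (y * z) := by
  by_contra! hcon
  have hcon' : ∀ z, word hd hσ he (x * z) = word hd hσ he (y * z) := hcon
  obtain ⟨p, hp⟩ := exists_eq_normalForm_word hd hσ he x
  obtain ⟨q, hq⟩ := exists_eq_normalForm_word hd hσ he y
  rw [← show word hd hσ he x = word hd hσ he y by simpa using hcon' 1] at hq
  set v := word hd hσ he x
  have hpq : p - q ≠ 0 := fun h => hxy (Subtype.ext (by rw [hp, hq, sub_eq_zero.1 h]))
  have h0 : ∀ w : List (Fin d), ∃ t, genB c e ^ (p - q) *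
      normalForm (genA c e) (genB c e) w 0 = normalForm (genA c e) (genB c e) w t := by
    intro w
    -- The test element has the word of `b ^ (-q) w`: multiplied by `y` it yields the word `v w`,
    -- and by `x` it yields `v` followed by the word of `b ^ (p - q) w`.
    obtain ⟨w₁, t₁, -, h₁⟩ :=
      exists_zpow_mul_normalForm (genA_mul_genB_zpow c e) hσ he hd w (-q)
    obtain ⟨w₂, t₂, -, h₂⟩ :=
      exists_zpow_mul_normalForm (genA_mul_genB_zpow c e) hσ he hd w₁ p
    have h₃ : genB c e ^ q * normalForm (genA c e) (genB c e) w₁ 0 =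
        normalForm (genA c e) (genB c e) w (-t₁) := by
      rw [← add_neg_cancel t₁, ← h₁, ← mul_assoc, ← zpow_add, add_neg_cancel, zpow_zero, one_mul]
    have h₄ : ∀ n, normalForm (genA c e) (genB c e) v n =
        normalForm (genA c e) (genB c e) v 0 * genB c e ^ n := fun n => by
      rw [normalForm_mul_zpow, zero_add]
    have h₅ := hcon' ⟨_, normalForm_mem c e w₁ le_rfl⟩
    rw [word_eq hc hd hσ he (w := v ++ w₂) (m := t₂ + 0) (by
        rw [Submonoid.coe_mul, hp, ← normalForm_zero_mul, ← h₂, ← mul_assoc, ← h₄]),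
      word_eq hc hd hσ he (w := v ++ w) (m := -t₁) (by
        rw [Submonoid.coe_mul, hq, ← normalForm_zero_mul, ← h₃, ← mul_assoc, ← h₄])] at h₅
    obtain rfl := List.append_cancel_left h₅
    exact ⟨t₂ + (t₁ + 0), by rw [← h₂, ← h₁, ← mul_assoc, ← zpow_add, sub_eq_add_neg]⟩
  have key : ∀ n : ℕ, ∃ r s : ℤ, s * s = 1 ∧ (d : ℤ) ^ n * r = s * ((p - q) * c ^ n) ∧
      ∀ w : List (Fin d), ∃ t, genB c e ^ r *
        normalForm (genA c e) (genB c e) w 0 = normalForm (genA c e) (genB c e) w t := by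
    intro n
    induction n with
    | zero => exact ⟨p - q, 1, by simp, by simp, h0⟩
    | succ n ih =>
      obtain ⟨r, s, hs, hr, h⟩ := ih
      obtain ⟨k, rfl, h'⟩ := dvd_of_forall_zpow_mul_normalForm hc hd hσ he h
      refine ⟨σ * c * k, σ * s, by linear_combination (s * s) * hσ + hs, ?_, h'⟩
      linear_combination (σ * c) * hr
  refine hdc (dvd_of_forall_pow_dvd hpq hd fun n => ?_)
  obtain ⟨r, s, hs, hr, -⟩ := key n
  exact ⟨r * s, by linear_combination (-(p - q) * c ^ n) * hs - s * hr⟩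

end BSGroup

/-! ## Initial segments of infinite words -/

/-- The finite word `l` is an initial segment of the infinite word `w`. -/
def IsInitialSegment {α : Type*} (l : List α) (w : ℕ → α) : Prop :=
  ∀ i (h : i < l.length), l[i] = w i

namespace IsInitialSegment

variable {α : Type*} {l l' : List α} {w : ℕ → α}

theorem nil (w : ℕ → α) : IsInitialSegment [] w := fun i h => absurd h (by simp)

theorem mono (h : IsInitialSegment l' w) (hl : l <+: l') : IsInitialSegment l w := by
  intro i hi
  rw [hl.getElem hi]
  exact h i _

theorem prefix_of_length_le (h : IsInitialSegment l w) (h' : IsInitialSegment l' w)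
    (hl : l.length ≤ l'.length) : l <+: l' := by
  rw [List.prefix_iff_eq_take]
  refine List.ext_getElem (by simp [hl]) fun i h1 h2 => ?_
  rw [List.getElem_take, h i h1, h' i]

theorem ofFn (w : ℕ → α) (n : ℕ) : IsInitialSegment (List.ofFn fun i : Fin n => w i) w := by
  intro i hi
  simp

theorem getD (l : List α) (z : α) : IsInitialSegment l fun i => l.getD i z := by
  intro i hi
  simp [hi]

/-- If `l'` were longer, `l` could be continued by a letter that disagrees with `l'`. -/
theorem prefix_of_forall [Nontrivial α] (h : ∀ w, IsInitialSegment l w → IsInitialSegment l' w) :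
    l' <+: l := by
  obtain ⟨z₀⟩ : Nonempty α := inferInstance
  rcases le_or_gt l'.length l.length with hl | hl
  · exact (h _ (getD l z₀)).prefix_of_length_le (getD l z₀) hl
  · obtain ⟨z, hz⟩ := exists_ne l'[l.length]
    have := h _ (getD l z) l.length hl
    simp only [List.getD_eq_default _ _ le_rfl] at this
    exact absurd this.symm hz

theorem isClopen [TopologicalSpace α] [DiscreteTopology α] (l : List α) :
    IsClopen {w | IsInitialSegment l w} := by
  have : {w | IsInitialSegment l w} = ⋂ i : Fin l.length, (fun w : ℕ → α => w i) ⁻¹' {l[i]} := by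
    ext w
    simp only [IsInitialSegment, Set.mem_ofPred_eq, Set.mem_iInter, Set.mem_preimage,
      Set.mem_singleton_iff]
    exact ⟨fun h i => (h i i.2).symm, fun h i hi => (h ⟨i, hi⟩).symm⟩
  rw [this]
  exact ⟨isClosed_iInter fun i => (isClosed_discrete _).preimage (continuous_apply _),
    isOpen_iInter_of_finite fun i => (isOpen_discrete _).preimage (continuous_apply _)⟩

theorem exists_of_directed [Nonempty α] {T : Set (List α)}
    (hT : ∀ l ∈ T, ∀ l' ∈ T, ∃ m, l <+: m ∧ l' <+: m) : ∃ w, ∀ l ∈ T, IsInitialSegment l w := by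
  classical
  refine ⟨fun i => if h : ∃ l ∈ T, i < l.length then h.choose[i]'h.choose_spec.2
    else Classical.arbitrary α, fun l hl i hi => ?_⟩
  have h : ∃ l ∈ T, i < l.length := ⟨l, hl, hi⟩
  obtain ⟨m, h1, h2⟩ := hT l hl _ h.choose_spec.1
  simp only [dif_pos h]
  rw [h1.getElem hi, h2.getElem h.choose_spec.2]

theorem exists_forall_mem [TopologicalSpace α] [DiscreteTopology α] {U : Set (ℕ → α)}
    (hU : IsOpen U) (hw : w ∈ U) :
    ∃ n, ∀ w', (∀ i < n, w' i = w i) → w' ∈ U := by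
  obtain ⟨I, u, h1, h2⟩ := isOpen_pi_iff.1 hU w hw
  refine ⟨I.sup id + 1, fun w' h => h2 fun i hi => ?_⟩
  rw [h i (Nat.lt_succ_of_le (Finset.le_sup (f := id) hi))]
  exact (h1 i hi).2

end IsInitialSegment

theorem IsContractive.isLocallyContractive {X : Type*} [TopologicalSpace X] [Groupoid X]
    [TopologicalSpace (Quiver.Total X)] (h : IsContractive X) : IsLocallyContractive X := by
  intro U hU hne
  obtain ⟨S, hS, h1, h2⟩ := h U hU hne
  refine ⟨U, hU, subset_rfl, S, hS, h1 ▸ Set.subset_univ _,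
    (Set.Subset.trans ?_ subset_closure).trans_ssubset h2⟩
  exact Set.image_mono fun g hg => ⟨hg.1, trivial⟩

/-- Strict inclusion makes `V` nonempty, so the translate of its closure is nonempty as well, and
hence everything. -/
theorem not_isLocallyContractive_of_subsingleton {X : Type*} [TopologicalSpace X] [Groupoid X]
    [TopologicalSpace (Quiver.Total X)] [Subsingleton X] [Nonempty X] :
    ¬ IsLocallyContractive X := by
  intro h
  obtain ⟨V, -, -, S, -, h1, h2⟩ := h Set.univ isOpen_univ Set.univ_nonempty
  obtain ⟨v, hv, hv'⟩ := Set.exists_of_ssubset h2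
  obtain ⟨g, hg, hgv⟩ := h1 (subset_closure hv)
  exact hv' ⟨g, ⟨hg, by simpa only [hgv] using subset_closure hv⟩, Subsingleton.elim _ _⟩

/-! ### Basic open sets in terms of membership -/

namespace DirHered

variable {M : Type*} [Monoid M]

theorem mem_hat_basicSet {α : M} {F : Finset M} {C : DirHered M} :
    C ∈ hat (basicSet α F) ↔ α ∈ C.carrier ∧ ∀ β ∈ F, β ∉ C.carrier := by
  constructor
  · rintro ⟨γ, hγ, h⟩
    refine ⟨C.hereditary γ hγ α (h ⟨hγ, dvd_refl γ⟩).1, fun β hβ hβC => ?_⟩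
    obtain ⟨δ, hδ, h1, h2⟩ := C.directed γ hγ β hβC
    exact (h ⟨hδ, h1⟩).2 β hβ h2
  · rintro ⟨hα, h⟩
    exact ⟨α, hα, fun δ hδ => ⟨hδ.2, fun β hβ hd => h β hβ (C.hereditary δ hδ.1 β hd)⟩⟩

theorem isOpen_hat {α : M} {F : Finset M} (hF : ∀ β ∈ F, α ∣ β ∧ β ≠ α) :
    IsOpen (hat (basicSet α F)) :=
  TopologicalSpace.isOpen_generateFrom_of_mem ⟨α, F, hF, rfl⟩

theorem isOpen_mem (α : M) : IsOpen {C : DirHered M | α ∈ C.carrier} := by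
  have : {C : DirHered M | α ∈ C.carrier} = hat (basicSet α ∅) := by
    ext C
    rw [mem_hat_basicSet]
    simp
  rw [this]
  exact isOpen_hat (by simp)

theorem hat_one_empty : hat (basicSet (1 : M) ∅) = Set.univ := by
  refine Set.eq_univ_of_forall fun C => mem_hat_basicSet.2 ⟨?_, by simp⟩
  obtain ⟨α, hα⟩ := C.nonempty
  exact C.hereditary α hα 1 (one_dvd α)

end DirHered

open DirHered

/-! ### The boundary as the space of infinite words -/

namespace WordMap

variable {M : Type*} [Monoid M] {d : ℕ} (W : WordMap M d)

theorem word_prefix_of_dvd {α β : M} (h : α ∣ β) : W.word α <+: W.word β := by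
  obtain ⟨γ, rfl⟩ := h
  exact W.word_prefix_mul α γ

theorem word_one : W.word 1 = [] := by
  have := W.length_word_mul 1 1
  rw [mul_one] at this
  exact List.eq_nil_of_length_eq_zero (by omega)

theorem word_mul_base_pow (α : M) (n : ℕ) : W.word (α * W.base ^ n) = W.word α := by
  induction n with
  | zero => simp
  | succ n ih => rw [pow_succ, ← mul_assoc, W.word_mul_base, ih]

theorem exists_word_eq (l : List (Fin d)) : ∃ α, W.word α = l := by
  induction l using List.reverseRecOn with
  | nil => exact ⟨1, W.word_one⟩
  | append_singleton l i ih =>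
    obtain ⟨α, rfl⟩ := ih
    obtain ⟨j, hj⟩ := W.exists_letter α i
    exact ⟨_, hj⟩

/-- The directed hereditary set of the elements whose word is an initial segment of `w`. -/
def point (w : ℕ → Fin d) : DirHered M where
  carrier := {α | IsInitialSegment (W.word α) w}
  nonempty := ⟨1, by simpa [W.word_one] using IsInitialSegment.nil w⟩
  directed := by
    intro α hα β hβ
    rcases le_total (W.word α).length (W.word β).length with h | h
    · obtain ⟨N, hN⟩ := W.exists_dvd α β (hα.prefix_of_length_le hβ h)
      exact ⟨β * W.base ^ N, by simpa [W.word_mul_base_pow] using hβ, hN, dvd_mul_right _ _⟩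
    · obtain ⟨N, hN⟩ := W.exists_dvd β α (hβ.prefix_of_length_le hα h)
      exact ⟨α * W.base ^ N, by simpa [W.word_mul_base_pow] using hα, dvd_mul_right _ _, hN⟩
  hereditary := fun β hβ α h => hβ.mono (W.word_prefix_of_dvd h)

theorem mem_point {w : ℕ → Fin d} {α : M} :
    α ∈ (W.point w).carrier ↔ IsInitialSegment (W.word α) w := Iff.rfl

theorem exists_mem_point (w : ℕ → Fin d) (n : ℕ) :
    ∃ α ∈ (W.point w).carrier, (W.word α).length = n := by
  obtain ⟨α, hα⟩ := W.exists_word_eq (List.ofFn fun i : Fin n => w i)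
  exact ⟨α, by rw [mem_point, hα]; exact .ofFn w n, by simp [hα]⟩

theorem eq_of_point_subset {w w' : ℕ → Fin d}
    (h : (W.point w).carrier ⊆ (W.point w').carrier) : w = w' := by
  funext n
  obtain ⟨α, hα, hl⟩ := W.exists_mem_point w (n + 1)
  exact (hα n (by omega)).symm.trans (h hα n (by omega))

/-- An element of `W.point w` divides `β * base ^ N` as soon as `β ∈ C` has a word at least as long,
and the two closure conditions keep such multiples in `C`. -/
theorem eq_point {C : DirHered M} {w : ℕ → Fin d} (hC : C.carrier ⊆ (W.point w).carrier)
    (h1 : ∀ α ∈ C.carrier, α * W.base ∈ C.carrier)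
    (h2 : ∀ α ∈ C.carrier, ∃ β ∈ C.carrier, (W.word α).length < (W.word β).length) :
    C = W.point w := by
  have h3 : ∀ n, ∃ β ∈ C.carrier, n ≤ (W.word β).length := by
    intro n
    induction n with
    | zero =>
      obtain ⟨α, hα⟩ := C.nonempty
      exact ⟨α, hα, Nat.zero_le _⟩
    | succ n ih =>
      obtain ⟨α, hα, hn⟩ := ih
      obtain ⟨β, hβ, hl⟩ := h2 α hα
      exact ⟨β, hβ, by omega⟩
  refine DirHered.ext (hC.antisymm fun δ hδ => ?_)
  obtain ⟨β, hβ, hl⟩ := h3 (W.word δ).length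
  obtain ⟨N, hN⟩ := W.exists_dvd δ β
    (IsInitialSegment.prefix_of_length_le hδ (W.mem_point.1 (hC hβ)) hl)
  refine C.hereditary _ ?_ δ hN
  clear hN
  induction N with
  | zero => simpa using hβ
  | succ N ih => rw [pow_succ, ← mul_assoc]; exact h1 _ ih

variable [NeZero d]

theorem exists_subset_point (C : DirHered M) : ∃ w, C.carrier ⊆ (W.point w).carrier := by
  obtain ⟨w, hw⟩ := IsInitialSegment.exists_of_directed (T := W.word '' C.carrier) (by
    rintro _ ⟨α, hα, rfl⟩ _ ⟨β, hβ, rfl⟩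
    obtain ⟨γ, -, h1, h2⟩ := C.directed α hα β hβ
    exact ⟨W.word γ, W.word_prefix_of_dvd h1, W.word_prefix_of_dvd h2⟩)
  exact ⟨w, fun α hα => hw _ ⟨α, hα, rfl⟩⟩

theorem maximals_eq_range_point : maximals M = Set.range W.point := by
  ext C
  constructor
  · intro hC
    obtain ⟨w, hw⟩ := W.exists_subset_point C
    exact ⟨w, hC _ hw⟩
  · rintro ⟨w, rfl⟩ D hD
    obtain ⟨w', hw'⟩ := W.exists_subset_point D
    obtain rfl := W.eq_of_point_subset (hD.trans hw')
    exact DirHered.ext (hw'.antisymm hD)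

/-- The maximal sets are already closed. If every maximal set containing `α` meets a finite set `F`
of proper extensions of `α`, so does every limit `C` containing `α` (`key`). The choices `{α *
base}` and `{α * letter j}` give the conditions of `eq_point`. -/
theorem boundary_eq_range_point : boundary M = Set.range W.point := by
  classical
  refine Set.Subset.antisymm (fun C hC => ?_)
    (W.maximals_eq_range_point ▸ subset_closure)
  have key : ∀ (α : M) (F : Finset M), (∀ β ∈ F, α ∣ β ∧ β ≠ α) → α ∈ C.carrier →
      (∀ w, α ∈ (W.point w).carrier → ∃ β ∈ F, β ∈ (W.point w).carrier) →
      ∃ β ∈ F, β ∈ C.carrier := by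
    intro α F hF hα h
    by_contra! hcon
    obtain ⟨D, hD, hDmax⟩ := mem_closure_iff.1 hC _ (isOpen_hat hF)
      (mem_hat_basicSet.2 ⟨hα, hcon⟩)
    rw [W.maximals_eq_range_point] at hDmax
    obtain ⟨w, rfl⟩ := hDmax
    rw [mem_hat_basicSet] at hD
    obtain ⟨β, hβ, hβw⟩ := h w hD.1
    exact hD.2 β hβ hβw
  obtain ⟨w, hw⟩ := W.exists_subset_point C
  refine ⟨w, (W.eq_point hw (fun α hα => ?_) fun α hα => ?_).symm⟩
  -- A basic open set may not remove `α` itself, hence the separate case.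
  · by_cases h : α * W.base = α
    · rwa [h]
    · simpa using key α {α * W.base} (by simpa using h) hα
        (fun w hw => by simpa [mem_point, W.word_mul_base] using hw)
  · obtain ⟨β, hβ, hβC⟩ := key α (Finset.univ.image fun j => α * W.letter j) (by
      intro β hβ
      obtain ⟨j, -, rfl⟩ := Finset.mem_image.1 hβ
      refine ⟨dvd_mul_right _ _, fun h => ?_⟩
      have := congrArg (fun x => (W.word x).length) h
      simp [W.length_word_mul, W.length_word_letter] at this) hα (by
      intro w hw
      obtain ⟨j, hj⟩ := W.exists_letter α (w (W.word α).length)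
      refine ⟨_, Finset.mem_image_of_mem _ (Finset.mem_univ j), ?_⟩
      rw [mem_point, hj]
      intro i hi
      rcases Nat.lt_or_ge i (W.word α).length with h | h
      · rw [List.getElem_append_left h]
        exact hw i h
      · obtain rfl : i = (W.word α).length := by simp at hi; omega
        simp)
    obtain ⟨j, -, rfl⟩ := Finset.mem_image.1 hβ
    exact ⟨_, hβC, by rw [W.length_word_mul, W.length_word_letter]; omega⟩

theorem point_mem_boundary (w : ℕ → Fin d) : W.point w ∈ boundary M :=
  W.boundary_eq_range_point ▸ Set.mem_range_self w

theorem nonempty_boundary (W : WordMap M d) : Nonempty (boundary M) :=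
  ⟨⟨_, W.point_mem_boundary 0⟩⟩

theorem exists_eq_point (x : boundary M) : ∃ w, x = ⟨W.point w, W.point_mem_boundary w⟩ := by
  obtain ⟨w, hw⟩ := (W.boundary_eq_range_point ▸ x.2 : x.1 ∈ Set.range W.point)
  exact ⟨w, Subtype.ext hw.symm⟩

end WordMap

/-! ### Cylinders, isotropy and dynamics on the boundary -/

namespace WordMap

variable {M : Type*} [Monoid M] {d : ℕ} (W : WordMap M d)

theorem exists_mem_forall_mem_of_isOpen {V : Set (DirHered M)} (hV : IsOpen V) (w : ℕ → Fin d)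
    (hw : W.point w ∈ V) : ∃ α ∈ (W.point w).carrier, ∀ w', α ∈ (W.point w').carrier →
      W.point w' ∈ V := by
  classical
  induction hV with
  | basic V hV =>
    obtain ⟨α, F, -, rfl⟩ := hV
    rw [mem_hat_basicSet] at hw
    -- Once `γ` is as long as `α` and all of `F`, its word decides which of them belong to a point
    -- containing `γ`.
    obtain ⟨γ, hγ, hl⟩ := W.exists_mem_point w ((insert α F).sup fun β => (W.word β).length)
    have hlen : ∀ β ∈ insert α F, (W.word β).length ≤ (W.word γ).length := fun β hβ =>
      hl ▸ Finset.le_sup (f := fun β => (W.word β).length) hβ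
    refine ⟨γ, hγ, fun w' hw' => mem_hat_basicSet.2 ⟨?_, fun β hβ hβw => hw.2 β hβ ?_⟩⟩
    · exact IsInitialSegment.mono hw'
        (IsInitialSegment.prefix_of_length_le hw.1 hγ (hlen α (Finset.mem_insert_self _ _)))
    · exact IsInitialSegment.mono hγ
        (IsInitialSegment.prefix_of_length_le hβw hw' (hlen β (Finset.mem_insert_of_mem hβ)))
  | univ => exact ⟨1, by simpa [mem_point, W.word_one] using .nil w, fun _ _ => trivial⟩
  | inter s t _ _ hs ht =>
    obtain ⟨α, hα, h1⟩ := hs hw.1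
    obtain ⟨β, hβ, h2⟩ := ht hw.2
    obtain ⟨γ, hγ, h3, h4⟩ := (W.point w).directed α hα β hβ
    exact ⟨γ, hγ, fun w' hw' => ⟨h1 w' ((W.point w').hereditary γ hw' α h3),
      h2 w' ((W.point w').hereditary γ hw' β h4)⟩⟩
  | sUnion S _ hS =>
    obtain ⟨V, hV, hwV⟩ := hw
    obtain ⟨α, hα, h⟩ := hS V hV hwV
    exact ⟨α, hα, fun w' hw' => ⟨V, hV, h w' hw'⟩⟩

theorem exists_notMem_point [Nontrivial (Fin d)] (α : M) :
    ∃ j w, α ∈ (W.point w).carrier ∧ α * W.letter j ∉ (W.point w).carrier := by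
  obtain ⟨i, k, hk⟩ := exists_pair_ne (Fin d)
  obtain ⟨j, hj⟩ := W.exists_letter α i
  refine ⟨j, fun n => (W.word α).getD n k, .getD _ _, fun h => hk ?_⟩
  rw [mem_point, hj] at h
  simpa using h (W.word α).length (by simp)

/-- The infinite words for which the corresponding point may be written as `α y = β y`. -/
def fixedWords (α β : M) : Set (ℕ → Fin d) :=
  {w | α ∈ (W.point w).carrier ∧ β ∈ (W.point w).carrier ∧
    ∀ γ, α * γ ∈ (W.point w).carrier ↔ β * γ ∈ (W.point w).carrier}

theorem isClosed_fixedWords (α β : M) : IsClosed (W.fixedWords α β) := by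
  have hm : ∀ α, IsClopen {w | α ∈ (W.point w).carrier} := fun α => IsInitialSegment.isClopen (W.word α)
  have : W.fixedWords α β = {w | α ∈ (W.point w).carrier} ∩ {w | β ∈ (W.point w).carrier} ∩
      ⋂ γ, ({w | α * γ ∈ (W.point w).carrier} ∩ {w | β * γ ∈ (W.point w).carrier} ∪
        {w | α * γ ∈ (W.point w).carrier}ᶜ ∩ {w | β * γ ∈ (W.point w).carrier}ᶜ) := by
    ext w
    simp only [fixedWords, iff_iff_and_or_not_and_not, Set.mem_ofPred_eq, Set.mem_inter_iff,
      Set.mem_iInter, Set.mem_union, Set.mem_compl_iff, and_assoc]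
  rw [this]
  exact ((hm α).inter (hm β)).1.inter (isClosed_iInter fun γ =>
    (((hm _).inter (hm _)).union ((hm _).compl.inter (hm _).compl)).1)

/-- If a cylinder consisted of fixed words, then below a suitable `α * ξ` the cylinder of `α * ξ *
γ` would lie in that of `β * ξ * γ`. Equal lengths turn this prefix relation into equality of words
for every `γ`, against `hW`. -/
theorem dense_compl_fixedWords [IsRightCancelMul M] [Nontrivial (Fin d)]
    (hW : ∀ α β, α ≠ β → ∃ γ, W.word (α * γ) ≠ W.word (β * γ)) {α β : M} (hαβ : α ≠ β) :
    Dense (W.fixedWords α β)ᶜ := by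
  rw [← interior_eq_empty_iff_dense_compl, Set.eq_empty_iff_forall_notMem]
  intro w hw
  obtain ⟨n, hn⟩ := IsInitialSegment.exists_forall_mem isOpen_interior hw
  -- Length at least `n` keeps the cylinder of `ζ` in the interior; length at least that of `α` lets
  -- `α` divide `ζ * base ^ N`.
  obtain ⟨ζ, hζ, hl⟩ := W.exists_mem_point w (max n (W.word α).length)
  have hfix : ∀ w', IsInitialSegment (W.word ζ) w' → w' ∈ W.fixedWords α β := fun w' hw' =>
    interior_subset (hn w' fun i hi => (hw' i (by omega)).symm.trans (hζ i (by omega)))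
  obtain ⟨N, ξ, hξ⟩ := W.exists_dvd α ζ
    (IsInitialSegment.prefix_of_length_le (hfix w hζ).1 hζ (by omega))
  have hword : W.word ζ = W.word (α * ξ) := by rw [← hξ, W.word_mul_base_pow]
  have hpre : ∀ γ, W.word (β * ξ * γ) <+: W.word (α * ξ * γ) := fun γ =>
    IsInitialSegment.prefix_of_forall fun w' hw' => by
      have := (hfix w' (hword ▸ hw'.mono (W.word_prefix_mul _ _))).2.2 (ξ * γ)
      rw [← mul_assoc, ← mul_assoc] at this
      exact this.1 hw'
  have hlen : (W.word (α * ξ)).length = (W.word (β * ξ)).length := by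
    -- For `γ` this long, the cylinder of `β * ξ * γ` also lies below `ζ`, so the roles of `α` and
    -- `β` can be exchanged.
    obtain ⟨γ, -, hγ⟩ := W.exists_mem_point w (W.word ζ).length
    refine le_antisymm ?_ (by simpa using (hpre 1).length_le)
    have hp : W.word ζ <+: W.word (β * ξ * γ) :=
      List.prefix_of_prefix_length_le (hword ▸ W.word_prefix_mul _ _) (hpre γ)
        (by rw [W.length_word_mul]; omega)
    have : W.word (α * ξ * γ) <+: W.word (β * ξ * γ) :=
      IsInitialSegment.prefix_of_forall fun w' hw' => by
        have := (hfix w' (hw'.mono hp)).2.2 (ξ * γ)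
        rw [← mul_assoc, ← mul_assoc] at this
        exact this.2 hw'
    have := this.length_le
    rw [W.length_word_mul, W.length_word_mul (β * ξ)] at this
    omega
  obtain ⟨γ, hγ⟩ := hW _ _ fun h : α * ξ = β * ξ => hαβ (mul_right_cancel h)
  exact hγ ((hpre γ).eq_of_length (by
    rw [W.length_word_mul, W.length_word_mul (α * ξ), hlen])).symm

variable [NeZero d]

theorem exists_forall_mem_of_isOpen (W : WordMap M d) {U : Set (boundary M)} (hU : IsOpen U)
    (hne : U.Nonempty) : ∃ α, ∀ x : boundary M, α ∈ x.1.carrier → x ∈ U := by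
  obtain ⟨V, hV, rfl⟩ := isOpen_induced_iff.1 hU
  obtain ⟨x, hx⟩ := hne
  obtain ⟨w, rfl⟩ := W.exists_eq_point x
  obtain ⟨α, -, h⟩ := W.exists_mem_forall_mem_of_isOpen hV w hx
  refine ⟨α, fun y hy => ?_⟩
  obtain ⟨w', rfl⟩ := W.exists_eq_point y
  exact h w' hy

theorem isClosed_mem (W : WordMap M d) (α : M) :
    IsClosed {x : boundary M | α ∈ x.1.carrier} := by
  rw [← isOpen_compl_iff, isOpen_iff_forall_mem_open]
  intro x hx
  obtain ⟨w, rfl⟩ := W.exists_eq_point x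
  obtain ⟨γ, hγ, hl⟩ := W.exists_mem_point w (W.word α).length
  refine ⟨{x | γ ∈ x.1.carrier}, fun y hy hαy => hx ?_,
    (isOpen_mem γ).preimage continuous_subtype_val, hγ⟩
  obtain ⟨w', rfl⟩ := W.exists_eq_point y
  exact IsInitialSegment.mono hγ (IsInitialSegment.prefix_of_length_le hαy hy hl.ge)

theorem shift_point [IsLeftCancelMul M] (α : M) (w : ℕ → Fin d) :
    ∃ w', shift α (W.point w) = W.point w' := by
  obtain ⟨w', hw'⟩ := W.exists_subset_point (shift α (W.point w))
  refine ⟨w', W.eq_point hw' ?_ ?_⟩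
  · rintro δ ⟨β, hβ, h⟩
    obtain ⟨N, hN⟩ := W.exists_dvd (δ * W.base) (α * β)
      (by rw [W.word_mul_base]; exact W.word_prefix_of_dvd h)
    exact ⟨β * W.base ^ N, by rwa [mem_point, W.word_mul_base_pow], by rwa [← mul_assoc]⟩
  · rintro δ -
    obtain ⟨β, hβ, h⟩ := W.exists_mem_point w ((W.word δ).length + 1)
    exact ⟨α * β, ⟨β, hβ, dvd_rfl⟩, by rw [W.length_word_mul]; omega⟩

variable [IsLeftCancelMul M]

theorem shift_mem_boundary (W : WordMap M d) (α : M) (x : boundary M) :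
    shift α x.1 ∈ boundary M := by
  obtain ⟨w, rfl⟩ := W.exists_eq_point x
  obtain ⟨w', h⟩ := W.shift_point α w
  rw [h]
  exact W.point_mem_boundary w'

/-- The translate of a boundary point. -/
def boundaryShift (W : WordMap M d) (α : M) (x : boundary M) : boundary M :=
  ⟨shift α x.1, W.shift_mem_boundary α x⟩

/-- The element `[α, 1, x]` of the restriction to the boundary. -/
def shiftHom (α : M) (x : boundary M) : x ⟶ W.boundaryShift α x :=
  show {g : PathGroupoid M // src g = x.1 ∧ rng g = shift α x.1} from
    ⟨cls α 1 x.1, shift_one _, rfl⟩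

theorem mem_boundaryShift (α : M) (x : boundary M) : α ∈ (W.boundaryShift α x).1.carrier := by
  obtain ⟨β, hβ⟩ := x.1.nonempty
  exact ⟨β, hβ, dvd_mul_right _ _⟩

/-- An open set contains the cylinder of some `α`, hence every `α x`, and the inverse of `[α, 1, x]`
carries `α x` to `x`. -/
theorem isMinimalGroupoid_boundary (W : WordMap M d) : IsMinimalGroupoid (boundary M) := by
  intro U hU hinv
  refine U.eq_empty_or_nonempty.imp_right fun hne => Set.eq_univ_of_forall fun x => ?_
  obtain ⟨α, hα⟩ := W.exists_forall_mem_of_isOpen hU hne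
  exact hinv (Groupoid.inv (W.shiftHom α x)) (hα _ (W.mem_boundaryShift α x))

/-- The elements `[α, 1, x]` of the restriction to the boundary. -/
def shiftBisection (α : M) : Set (Quiver.Total (boundary M)) :=
  {g | ∃ x, boundaryElement g = cls α 1 x}

theorem left_eq_of_boundaryElement_eq {α : M} {x : DirHered M} {g : Quiver.Total (boundary M)}
    (h : boundaryElement g = cls α 1 x) : g.left.1 = x ∧ g.right.1 = shift α x := by
  have h1 : src (boundaryElement g) = g.left.1 := g.hom.2.1
  have h2 : rng (boundaryElement g) = g.right.1 := g.hom.2.2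
  rw [h] at h1 h2
  exact ⟨h1.symm.trans (shift_one x), h2.symm⟩

theorem boundaryElement_injective : Function.Injective (boundaryElement (M := M)) := by
  rintro ⟨x, y, g⟩ ⟨x', y', g'⟩ e
  have e' : g.1 = g'.1 := e
  obtain rfl : x = x' := Subtype.ext (g.2.1.symm.trans ((congrArg src e').trans g'.2.1))
  obtain rfl : y = y' := Subtype.ext (g.2.2.symm.trans ((congrArg rng e').trans g'.2.2))
  obtain rfl : g = g' := Subtype.ext e'
  rfl

theorem isOpenBisection_shiftBisection (α : M) :
    IsOpenBisection (shiftBisection (M := M) α) where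
  isOpen := by
    refine isOpen_induced_iff.2 ⟨cls α 1 '' hat (basicSet 1 ∅),
      TopologicalSpace.isOpen_generateFrom_of_mem ⟨α, 1, 1, ∅, by simp, rfl⟩, ?_⟩
    ext g
    simp only [hat_one_empty, shiftBisection, Set.mem_preimage, Set.image_univ, Set.mem_range,
      Set.mem_ofPred_eq, eq_comm]
  injOn_source := by
    rintro g ⟨x, hx⟩ h ⟨y, hy⟩ e
    refine boundaryElement_injective ?_
    rw [hx, hy, ← (left_eq_of_boundaryElement_eq hx).1, ← (left_eq_of_boundaryElement_eq hy).1]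
    exact congrArg (fun z : boundary M => cls α 1 z.1) e
  injOn_range := by
    rintro g ⟨x, hx⟩ h ⟨y, hy⟩ e
    refine boundaryElement_injective ?_
    have e' : g.right.1 = h.right.1 := congrArg Subtype.val e
    rw [(left_eq_of_boundaryElement_eq hx).2, (left_eq_of_boundaryElement_eq hy).2] at e'
    rw [hx, hy, shift_injective α e']

/-- Inside a cylinder of `α` contained in `U`, translation by `α * letter j` maps the whole boundary
into a closed cylinder that misses some point of the first one. -/
theorem isContractive_boundary (W : WordMap M d) (hd : 1 < d) : IsContractive (boundary M) := by
  have : Nontrivial (Fin d) := Fin.nontrivial_iff_two_le.2 hd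
  intro U hU hne
  obtain ⟨α, hα⟩ := W.exists_forall_mem_of_isOpen hU hne
  obtain ⟨j, w, hw, hwj⟩ := W.exists_notMem_point α
  have hsub : closure (bisectionImage (shiftBisection (α * W.letter j)) Set.univ) ⊆
      {x : boundary M | α * W.letter j ∈ x.1.carrier} := by
    refine closure_minimal ?_ (W.isClosed_mem _)
    rintro _ ⟨g, ⟨⟨x, hx⟩, -⟩, rfl⟩
    obtain ⟨β, hβ⟩ := x.nonempty
    change _ ∈ g.right.1.carrier
    rw [(left_eq_of_boundaryElement_eq hx).2]
    exact ⟨β, hβ, dvd_mul_right _ _⟩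
  refine ⟨_, isOpenBisection_shiftBisection (α * W.letter j), Set.eq_univ_of_forall fun x =>
    ⟨⟨x, _, W.shiftHom _ x⟩, ⟨x.1, rfl⟩, rfl⟩, (Set.ssubset_iff_of_subset fun x hx =>
      hα x (x.1.hereditary _ (hsub hx) _ (dvd_mul_right _ _))).2
    ⟨⟨_, W.point_mem_boundary w⟩, hα _ hw, fun h => hwj (hsub h)⟩⟩

theorem not_isLocallyContractive_boundary (W : WordMap M 1) :
    ¬ IsLocallyContractive (boundary M) := by
  have := W.nonempty_boundary
  have : Subsingleton (boundary M) := ⟨fun x y => by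
    obtain ⟨w, rfl⟩ := W.exists_eq_point x
    obtain ⟨w', rfl⟩ := W.exists_eq_point y
    rw [Subsingleton.elim w w']⟩
  exact not_isLocallyContractive_of_subsingleton

theorem isContractive_boundary_iff (W : WordMap M d) : IsContractive (boundary M) ↔ 1 < d := by
  refine ⟨fun h => ?_, W.isContractive_boundary⟩
  by_contra hd
  obtain rfl : d = 1 := by have := NeZero.pos d; omega
  exact W.not_isLocallyContractive_boundary h.isLocallyContractive

theorem isLocallyContractive_boundary_iff (W : WordMap M d) :
    IsLocallyContractive (boundary M) ↔ 1 < d := by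
  refine ⟨fun h => ?_, fun h => (W.isContractive_boundary h).isLocallyContractive⟩
  by_contra hd
  obtain rfl : d = 1 := by have := NeZero.pos d; omega
  exact W.not_isLocallyContractive_boundary h

/-- An isotropy element `[α, β, y]` with `α ≠ β` would place `w` in `fixedWords α β`, and `[α, α,
y]` is a unit. -/
theorem eq_id_of_notMem_fixedWords {w : ℕ → Fin d}
    (hw : ∀ α β, α ≠ β → w ∉ W.fixedWords α β)
    (g : (⟨W.point w, W.point_mem_boundary w⟩ : boundary M) ⟶ ⟨W.point w, W.point_mem_boundary w⟩) :
    g = 𝟙 _ := by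
  obtain ⟨g, h1, h2⟩ := g
  obtain ⟨α, β, y, rfl⟩ := exists_cls g
  change shift β y = W.point w at h1
  change shift α y = W.point w at h2
  by_cases h : α = β
  · subst h
    refine Subtype.ext ?_
    change cls α α y = cls 1 1 (W.point w)
    rw [← h1, cls_shift, one_mul]
  · have hmem : ∀ γ, γ ∈ (shift γ y).carrier := fun γ => by
      obtain ⟨δ, hδ⟩ := y.nonempty
      exact ⟨δ, hδ, dvd_mul_right _ _⟩
    refine absurd ⟨h2 ▸ hmem α, h1 ▸ hmem β, fun γ => ?_⟩ (hw α β h)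
    rw [← h2, mul_mem_shift, h2, ← h1, mul_mem_shift]

variable [IsRightCancelMul M]

/-- Such a `z` fixes every boundary point `x`, and right cancellation keeps `[z, 1, x]` from being a
unit. -/
theorem not_isTopologicallyFree_boundary {z : M} (hz : z ≠ 1)
    (h : ∀ β, W.word (z * β) = W.word β) : ¬ IsTopologicallyFree (boundary M) := by
  intro hfree
  have := W.nonempty_boundary
  obtain ⟨x, hx⟩ := hfree.nonempty
  obtain ⟨w, rfl⟩ := W.exists_eq_point x
  have hw : shift z (W.point w) = W.point w := by
    obtain ⟨w', hw'⟩ := W.shift_point z w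
    obtain rfl : w' = w := W.eq_of_point_subset (by
      rw [← hw']
      rintro δ ⟨β, hβ, hδ⟩
      refine IsInitialSegment.mono hβ ?_
      rw [← h β]
      exact W.word_prefix_of_dvd hδ)
    exact hw'
  have e : cls z 1 (W.point w) = cls 1 1 (W.point w) :=
    congrArg Subtype.val (hx ⟨cls z 1 (W.point w), shift_one _, hw⟩)
  obtain ⟨y, γ, γ', -, -, h1, h2⟩ := cls_eq_iff.1 e
  exact hz (mul_right_cancel (h1.trans h2.symm))

/-- Baire's theorem in the space of infinite words: words outside all the countably many sets
`fixedWords α β`, `α ≠ β`, are dense and have trivial isotropy. -/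
theorem isTopologicallyFree_boundary [Countable M] (hd : 1 < d)
    (hW : ∀ α β, α ≠ β → ∃ γ, W.word (α * γ) ≠ W.word (β * γ)) :
    IsTopologicallyFree (boundary M) := by
  have : Nontrivial (Fin d) := Fin.nontrivial_iff_two_le.2 hd
  have hdense : Dense (⋂ p : {p : M × M // p.1 ≠ p.2}, (W.fixedWords p.1.1 p.1.2)ᶜ) :=
    dense_iInter_of_isOpen (fun p => (W.isClosed_fixedWords _ _).isOpen_compl)
      fun p => W.dense_compl_fixedWords hW p.2
  refine dense_iff_inter_open.2 fun U hU hne => ?_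
  obtain ⟨α, hα⟩ := W.exists_forall_mem_of_isOpen hU hne
  obtain ⟨w, hw, hwd⟩ := hdense.inter_open_nonempty _ (IsInitialSegment.isClopen (W.word α)).2
    ⟨_, .getD (W.word α) 0⟩
  refine ⟨⟨_, W.point_mem_boundary w⟩, hα _ hw, W.eq_id_of_notMem_fixedWords fun β γ h => ?_⟩
  exact Set.mem_iInter.1 hwd ⟨(β, γ), h⟩

end WordMap

theorem countable_bsMonoid (c e : ℤ) : Countable (bsMonoid c e) := by
  classical
  have : Countable BSGen :=
    Function.Injective.countable (f := fun x : BSGen => match x with | .a => true | .b => false)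
      (by rintro ⟨⟩ ⟨⟩ h <;> simp_all)
  have : Countable (FreeGroup BSGen) := FreeGroup.toWord_injective.countable
  have : Countable (BSGroup c e) := (PresentedGroup.mk_surjective _).countable
  infer_instance

theorem theoremt (c d : ℕ) (hc : 0 < c) (hd : 0 < d) (e : ℤ) (he : e = d ∨ e = -d) :
    IsMinimalGroupoid (DirHered.boundary (bsMonoid c e)) ∧
    (IsContractive (DirHered.boundary (bsMonoid c e)) ↔ 1 < d) ∧
    (IsLocallyContractive (DirHered.boundary (bsMonoid c e)) ↔ 1 < d) ∧
    (IsTopologicallyFree (DirHered.boundary (bsMonoid c e)) ↔ ¬ d ∣ c) := by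
  obtain ⟨σ, hσ, he'⟩ : ∃ σ : ℤ, σ * σ = 1 ∧ e = σ * d := by
    rcases he with rfl | rfl
    · exact ⟨1, by simp, by simp⟩
    · exact ⟨-1, by simp, by simp⟩
  have hc' : (c : ℤ) ≠ 0 := by omega
  have : NeZero d := ⟨hd.ne'⟩
  have := countable_bsMonoid c e
  let W := BSGroup.wordMap hc' hd hσ he'
  refine ⟨W.isMinimalGroupoid_boundary, W.isContractive_boundary_iff,
    W.isLocallyContractive_boundary_iff, ⟨fun h hdc => ?_, fun hdc => ?_⟩⟩
  · obtain ⟨z, hz, h'⟩ :=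
      BSGroup.exists_ne_one_word_mul hc' hd hσ he' (Int.natCast_dvd_natCast.2 hdc)
    exact W.not_isTopologicallyFree_boundary hz h' h
  -- Since `1` divides `c`, the assumption `d ∤ c` excludes the one-point boundary.
  · have hd1 : 1 < d := by
      rcases Nat.lt_or_ge 1 d with h | h
      · exact h
      · obtain rfl : d = 1 := by omega
        exact absurd (one_dvd c) hdc
    exact W.isTopologicallyFree_boundary hd1 fun x y hxy =>
      BSGroup.exists_word_mul_ne hc' hd hσ he' (mt Int.natCast_dvd_natCast.1 hdc) hxy
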